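/- Let $d,\alpha\ge 1$ be integers and $B\in\mathbb R$. All balls and distances in $\mathbb R^d$ are those of the $\ell_\infty$ norm. There is a constant $C>0$ depending only on $d,\alpha,B$ with the following property. Setting. Let $\mathcal X\subseteq[0,1]^d$ be measurable, let $\rho$ be a Borel probability measure on $\mathcal X\times\{-1,1\}$ with marginal $\rho_X$ on $\mathcal X$, let $\eta(\boldsymbol x)=\rho(y=1\mid\boldsymbol x)$ and let $f_c(\boldsymbol x)=1$ if $\eta(\boldsymbol x)\ge 1-\eta(\boldsymbol x)$, $f_c(\boldsymbol x)=-1$ otherwise (the Bayes rule). Let $\delta,\zeta>0$, $C_0\in(0,1]$ and $n\ge1$. Assume: (i) the identity maps $J_\rho:L^1(\mathcal X)\to L^1_{\rho_X}(\mathcal X)$ and $\bar J_\rho:L^1_{\rho_X}(\mathcal X)\to L^1(\mathcal X)$ (Lebesgue measure on $\mathcal X$) have finite operator norms $\|J_\rho\|$, $\|\bar J_\rho\|$; (ii) $\|\boldsymbol x_A-\boldsymbol x_B\|_\infty\ge2\delta$ whenever $\boldsymbol x_A,\boldsymbol x_B\in\mathcal X$, $f_c(\boldsymbol x_A)=1$,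 $f_c(\boldsymbol x_B)=-1$; (iii) $\eta\in W^\alpha_\infty(\mathcal X)$ with norm at most $B$, i.e. $\eta$ is on $\mathcal X$ the restriction of a $C^{\alpha-1}$ function on $[0,1]^d$ whose derivatives of order $\le\alpha-1$ are bounded by $B$ and whose derivative of order $\alpha-1$ is $B$-Lipschitz; (iv) $|\eta(\boldsymbol x)-\tfrac12|>\zeta$ for all $\boldsymbol x\in\mathcal X$. For a classifier $f$ with values in $\{-1,1\}$ put $\mathcal R(f)=\rho\{yf(\boldsymbol x)=-1\}$ and $\mathcal R^\delta(f)=\rho\{(\boldsymbol x,y):\ yf(\boldsymbol x')=-1\text{ for some }\boldsymbol x'\in\mathcal X,\ \|\boldsymbol x'-\boldsymbol x\|_\infty\le\delta\}$, and let $\mathcal R^\delta(f_c^\delta)$ be the least value of $\mathcal R^\delta$ over measurable classifiers. Let $\operatorname{sgn}(t)=1$ for $t\ge0$ and $-1$ for $t<0$. For a sample $D=\{(\boldsymbol x_i,y_i)\}_{i=1}^n$ and a loss $\phi$ put $\widehat{\mathcal E}_D^{\phi,\delta}(f)=\frac1n\sum_{i=1}^n\max_{\|\boldsymbol x_i'-\boldsymbol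 x_i\|_\infty\le\delta}\phi(y_if(\boldsymbol x_i'))$. Let $q_X=\frac12\min_{i\ne j}\|\boldsymbol x_i-\boldsymbol x_j\|_\infty$ ($=\infty$ if $n=1$). A ReLU network of depth $L$ and widths $d_1,\dots,d_L$ is a function $\boldsymbol c\cdot\sigma\circ\mathcal A_L\circ\dots\circ\sigma\circ\mathcal A_1$ with affine maps $\mathcal A_\ell:\mathbb R^{d_{\ell-1}}\to\mathbb R^{d_\ell}$, $d_0=d$, and $\sigma(t)=\max\{t,0\}$ applied coordinatewise. Conclusion. There are a depth $1\le L\le C\log\frac1\zeta$ and widths $d_1,d_2\le C(\zeta^{-d/\alpha}\log\frac1\zeta+n)$, $d_3,\dots,d_L\le C\,\zeta^{-d/\alpha}\log\frac1\zeta$, and an infinite family of (measurable) estimators $D\mapsto g_{k,D}$, $k\in\mathbb N$, such that for every sample $D$ in $\mathcal X\times\{-1,1\}$ with $\delta<q_X/3$ the functions $g_{k,D}$ are pairwise different on $\mathcal X$, each $g_{k,D}$ is a minimizer of the empirical adversarial risk $\widehat{\mathcal E}_D^{\phi,\delta}$ with the hinge loss $\phi(t)=\max\{1-t,0\}$ over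 all networks of this depth and these widths, and for every $\beta\in(0,1)$ the scaled function $\widehat f_D=\log\frac1\beta\cdot g_{k,D}$ is a network of this depth and these widths with at most $C(\zeta^{-d/\alpha}\log\frac1\zeta+n)$ non-zero parameters, whose empirical adversarial risk with the logistic loss $\phi(t)=\log(1+e^{-t})$ satisfies $\widehat{\mathcal E}_D^{\phi,\delta}(\widehat f_D)\le\beta$, and $$\mathcal R(\operatorname{sgn}\widehat f_D)-\mathcal R(f_c)\le2\|J_\rho\|\,((2+2C_0)\delta)^d\,n,\qquad \mathcal R^\delta(\operatorname{sgn}\widehat f_D)-\mathcal R^\delta(f_c^\delta)\le3\|J_\rho\|\,((4+2C_0)\delta)^d\,n .$$ In particular, for $D$ drawn i.i.d. from $\rho$, conditionally on $\delta<q_X/3$, $$\mathbb E\big[\mathcal R(\operatorname{sgn}\widehat f_D)-\mathcal R(f_c)\big]\le2\|J_\rho\|\,((2+2C_0)\delta)^d\,n,\qquad \mathbb E\big[\mathcal R^\delta(\operatorname{sgn}\widehat f_D)-\mathcal R^\delta(f_c^\delta)\big]\le3\|J_\rho\|\,((4+2C_0)\delta)^d\,n .$$ -/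

import Mathlib

open MeasureTheory ProbabilityTheory
open scoped ENNReal

noncomputable section

namespace AdvTrain

/-- `ℝ^d` with the `ℓ_∞` norm: `dist`, `closedBall` are those of the `ℓ_∞` norm. -/
abbrev Pt (d : ℕ) : Type := Fin d → ℝ

/-- A sample of size `n` of pairs (input, label). -/
abbrev Sample (d n : ℕ) : Type := Fin n → Pt d × ℝ

/-- The unit cube `[0,1]^d`. -/
def cube (d : ℕ) : Set (Pt d) := Set.Icc 0 1

/-! ### ReLU networks -/

/-- Dimension of the layers: the input has dimension `d`, hidden layer `ℓ ≥ 1` has width `w ℓ`. -/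
def layerDim (d : ℕ) (w : ℕ → ℕ) : ℕ → ℕ
  | 0 => d
  | ℓ + 1 => w (ℓ + 1)

/-- Parameters of a fully connected network; only `W ℓ`, `b ℓ` with `ℓ < L` are used, and
`W ℓ`, `b ℓ` are the weights and biases of the affine map into hidden layer `ℓ + 1`. -/
structure ReLUNet (d L : ℕ) (w : ℕ → ℕ) where
  W : ∀ ℓ : ℕ, Matrix (Fin (layerDim d w (ℓ + 1))) (Fin (layerDim d w ℓ)) ℝ
  b : ∀ ℓ : ℕ, Fin (layerDim d w (ℓ + 1)) → ℝ
  c : Fin (layerDim d w L) → ℝ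

namespace ReLUNet

variable {d L : ℕ} {w : ℕ → ℕ}

/-- Output of hidden layer `ℓ` (layer `0` is the input). -/
def hidden (N : ReLUNet d L w) : ∀ ℓ : ℕ, Pt d → Fin (layerDim d w ℓ) → ℝ
  | 0, x => x
  | ℓ + 1, x => fun i => max ((N.W ℓ).mulVec (N.hidden ℓ x) i + N.b ℓ i) 0

/-- The function `x ↦ c · σ(A_L σ(A_{L-1} ⋯ σ(A_1 x)))` computed by the network. -/
def toFun (N : ReLUNet d L w) (x : Pt d) : ℝ := ∑ i, N.c i * N.hidden L x i

open Classical in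
/-- The number of non-zero parameters (weights, biases and output coefficients). -/
def numNonzero (N : ReLUNet d L w) : ℕ :=
  (∑ ℓ ∈ Finset.range L,
    ((Finset.univ.filter fun p : Fin (layerDim d w (ℓ + 1)) × Fin (layerDim d w ℓ) =>
        N.W ℓ p.1 p.2 ≠ 0).card
      + (Finset.univ.filter fun i : Fin (layerDim d w (ℓ + 1)) => N.b ℓ i ≠ 0).card))
  + (Finset.univ.filter fun i : Fin (layerDim d w L) => N.c i ≠ 0).card

end ReLUNet

/-- The hypothesis space of all networks of depth `L` with hidden widths `w 1, …, w L`. -/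
def hypothesisSpace (d L : ℕ) (w : ℕ → ℕ) : Set (Pt d → ℝ) :=
  {f | ∃ N : ReLUNet d L w, f = N.toFun}

/-- The functions computed by such networks with at most `K` non-zero parameters. -/
def sparseHypothesisSpace (d L : ℕ) (w : ℕ → ℕ) (K : ℝ) : Set (Pt d → ℝ) :=
  {f | ∃ N : ReLUNet d L w, (N.numNonzero : ℝ) ≤ K ∧ f = N.toFun}

/-! ### Losses and risks -/

/-- The hinge loss. -/
def hinge (t : ℝ) : ℝ := max (1 - t) 0

/-- The logistic loss. -/
def logistic (t : ℝ) : ℝ := Real.log (1 + Real.exp (-t))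

/-- The empirical adversarial `φ`-risk. For continuous `f` and `φ` the supremum over the compact
`ℓ_∞` ball is a maximum. -/
def advEmpRisk {d n : ℕ} (φ : ℝ → ℝ) (δ : ℝ) (D : Sample d n) (f : Pt d → ℝ) : ℝ :=
  (1 / (n : ℝ)) * ∑ i, ⨆ x' : Metric.closedBall (D i).1 δ, φ ((D i).2 * f x')

/-- Global minimizers of the empirical adversarial `φ`-risk over a hypothesis space. -/
def advMinimizers {d n : ℕ} (φ : ℝ → ℝ) (δ : ℝ) (D : Sample d n) (F : Set (Pt d → ℝ)) :
    Set (Pt d → ℝ) :=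
  {f | f ∈ F ∧ ∀ h ∈ F, advEmpRisk φ δ D f ≤ advEmpRisk φ δ D h}

/-- The sign with values in `{-1, 1}`, where `sgn 0 = 1`. -/
def sgn (t : ℝ) : ℝ := if 0 ≤ t then 1 else -1

/-- The standard misclassification error `ρ(y f(x) = -1)` of a classifier `f`. -/
def misclass {d : ℕ} (ρ : Measure (Pt d × ℝ)) (f : Pt d → ℝ) : ℝ :=
  (ρ {z | z.2 * f z.1 = -1}).toReal

/-- The adversarial misclassification error: the (outer) probability that some input of `X` within
`ℓ_∞` distance `δ` of `x` is misclassified. -/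
def advMisclass {d : ℕ} (ρ : Measure (Pt d × ℝ)) (X : Set (Pt d)) (δ : ℝ) (f : Pt d → ℝ) : ℝ :=
  (ρ {z | ∃ x' ∈ X, dist x' z.1 ≤ δ ∧ z.2 * f x' = -1}).toReal

/-- The least adversarial misclassification error over all measurable classifiers. -/
def bestAdvMisclass {d : ℕ} (ρ : Measure (Pt d × ℝ)) (X : Set (Pt d)) (δ : ℝ) : ℝ :=
  sInf {r | ∃ h : Pt d → ℝ, Measurable h ∧ (∀ x, h x = 1 ∨ h x = -1) ∧ r = advMisclass ρ X δ h}

/-- The Bayes rule belonging to `η(x) = ρ(y = 1 | x)`. -/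
def bayes {d : ℕ} (η : Pt d → ℝ) (x : Pt d) : ℝ := if 1 - η x ≤ η x then 1 else -1

/-! ### Data distribution -/

/-- `ρ` is a distribution of (input, label) on `X × {-1, 1}`. -/
def IsDataDistribution {d : ℕ} (X : Set (Pt d)) (ρ : Measure (Pt d × ℝ)) : Prop :=
  IsProbabilityMeasure ρ ∧ ρ (X ×ˢ ({-1, 1} : Set ℝ))ᶜ = 0

/-- The marginal distribution of the input. -/
def marginal {d : ℕ} (ρ : Measure (Pt d × ℝ)) : Measure (Pt d) := ρ.map Prod.fst

/-- `η` is a version of the conditional probability `x ↦ ρ(y = 1 | x)` on `X`. -/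
def IsCondProbOne {d : ℕ} (X : Set (Pt d)) (ρ : Measure (Pt d × ℝ)) (η : Pt d → ℝ) : Prop :=
  Measurable η ∧ (∀ x ∈ X, 0 ≤ η x ∧ η x ≤ 1) ∧
    ∀ S : Set (Pt d), MeasurableSet S →
      ρ (S ×ˢ {1}) = ∫⁻ x in S, ENNReal.ofReal (η x) ∂(marginal ρ)

/-- The operator norm of the identity map `L¹(μ) → L¹(ν)` (`∞` if it is unbounded or not defined). -/
def idL1Norm {d : ℕ} (μ ν : Measure (Pt d)) : ℝ≥0∞ :=
  sInf {K | ∀ f : Pt d → ℝ, Measurable f → ∫⁻ x, ‖f x‖ₑ ∂ν ≤ K * ∫⁻ x, ‖f x‖ₑ ∂μ}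

/-- The norm of the identity map from `L¹(X)` (Lebesgue measure) to `L¹(ρ_X)`. -/
def normJ {d : ℕ} (X : Set (Pt d)) (ρ : Measure (Pt d × ℝ)) : ℝ≥0∞ :=
  idL1Norm (volume.restrict X) (marginal ρ)

/-- The norm of the identity map from `L¹(ρ_X)` to `L¹(X)` (Lebesgue measure). -/
def normJbar {d : ℕ} (X : Set (Pt d)) (ρ : Measure (Pt d × ℝ)) : ℝ≥0∞ :=
  idL1Norm (marginal ρ) (volume.restrict X)

/-- For an integer `α ≥ 1`: on `X`, the function `f` is the restriction of an `(α - 1)`-times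
continuously differentiable function on the cube, all of whose derivatives of order at most
`α - 1` are bounded by `B` and whose derivative of order `α - 1` is `B`-Lipschitz; that is, `f`
lies in the ball of radius `B` of `W^α_∞`, up to equivalence of norms. -/
def InHolderBall {d : ℕ} (α : ℕ) (B : ℝ) (X : Set (Pt d)) (f : Pt d → ℝ) : Prop :=
  ∃ F : Pt d → ℝ,
    ContDiffOn ℝ ((α - 1 : ℕ) : WithTop ℕ∞) F (cube d) ∧
    (∀ j ≤ α - 1, ∀ x ∈ cube d, ‖iteratedFDerivWithin ℝ j F (cube d) x‖ ≤ B) ∧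
    (∀ x ∈ cube d, ∀ y ∈ cube d,
      ‖iteratedFDerivWithin ℝ (α - 1) F (cube d) x - iteratedFDerivWithin ℝ (α - 1) F (cube d) y‖
        ≤ B * dist x y) ∧
    ∀ x ∈ X, F x = f x

/-- The two classes given by the Bayes rule are `2δ`-separated in the `ℓ_∞` distance. -/
def WellSeparated {d : ℕ} (X : Set (Pt d)) (η : Pt d → ℝ) (δ : ℝ) : Prop :=
  ∀ x ∈ X, ∀ x' ∈ X, bayes η x = 1 → bayes η x' = -1 → 2 * δ ≤ dist x x'

/-- The separation distance `q_X` of the inputs of a sample (`∞` for a single point). -/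
def separation {d n : ℕ} (D : Sample d n) : ℝ≥0∞ :=
  (⨅ (i : Fin n) (j : Fin n) (_ : i ≠ j), edist (D i).1 (D j).1) / 2

/-- The samples from `X × {-1, 1}` with separation distance `q_X > 3δ`. -/
def separatedSamples (d n : ℕ) (X : Set (Pt d)) (δ : ℝ) : Set (Sample d n) :=
  {D | (∀ i, D i ∈ X ×ˢ ({-1, 1} : Set ℝ)) ∧ ENNReal.ofReal δ < separation D / 3}

/-- Conditional expectation value of `g ≥ 0` over an i.i.d. sample of size `n`, given `q_X > 3δ`. -/
def expectSep {d : ℕ} (n : ℕ) (ρ : Measure (Pt d × ℝ)) (X : Set (Pt d)) (δ : ℝ)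
    (g : Sample d n → ℝ) : ℝ≥0∞ :=
  ∫⁻ D, ENNReal.ofReal (g D) ∂((Measure.pi fun _ : Fin n => ρ)[|separatedSamples d n X δ])

end AdvTrain

end

/-! Every estimator is a positive multiple of `T + A * (b₊ - b₋)`. Here `T` depends on η but not on
the sample, and its sign is the Bayes rule on all of `X`. The functions `b₊`, `b₋` are sums of bumps
at the positively and negatively labelled sample points; each bump is 1 on the δ-ball and 0 off the
ball of radius (1 + C₀)δ. As q_X > 3δ, sample points are more than 6δ apart, so only its own bump
acts on a given δ-ball. With A ≥ |T| + 1 the margin y·g is then at least 1 on every δ-ball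
(`one_le_mul_interpolant`). The adversarial hinge risk vanishes, and it also vanishes for the
multiples by k + 1. These multiples are distinct because the function is non-zero at the sample
points. The further factor log(1/β) pushes the logistic loss below β.

The network `T` needs no partition of unity (`exists_sign_polynomials`). At each point c of a grid
of mesh of order ζ^(1/α), take the Taylor polynomial of η - 1/2 and subtract K·∑(x_j - c_j)^(2α)
with K of order 1/ζ. The penalty is at least K times the squared distance power whose first power
controls the Taylor error, so it absorbs this error up to ζ/2. The resulting polynomial is at most
-ζ/2 on the whole negative class, yet at least ζ/2 at points of the positive class near c. Hence the
sum of the positive parts over the grid, lowered by a small constant, has the right sign.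

All these polynomials are combinations of the same (d+1)^(2α) monomials. Iterated tent maps compute
them to accuracy of order 4^(-m) with a number of active units per layer that depends only on d and
α (`abs_monoApprox_sub_le`, `IsReadable.monoApprox`). The coefficients are O(1/ζ), so m of order
log(1/ζ) suffices. The grid size, of order ζ^(-d/α), counts active units only in the last layer, and
n only in the first two.

Away from the sample the sign agrees with the Bayes rule, so the excess risk is at most the ρ_X-mass
of n balls, which ‖J_ρ‖ bounds by volume. For the adversarial risk the balls grow by δ: the
2δ-separation makes the Bayes rule constant under perturbations, and the Bayes risk is a lower bound
for every adversarial risk. The bounds hold for each sample, hence also in conditional expectation.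
-/

noncomputable section

namespace AdvTrain

/-! ### Building networks layer by layer -/

section Networks

variable {d : ℕ} {w : ℕ → ℕ}

open Classical in
/-- The number of non-zero weights and biases of the first `ℓ` layers. -/
def ReLUNet.weightCount {L : ℕ} (N : ReLUNet d L w) (ℓ : ℕ) : ℕ :=
  ∑ l ∈ Finset.range ℓ,
    ((Finset.univ.filter fun p : Fin (layerDim d w (l + 1)) × Fin (layerDim d w l) =>
        N.W l p.1 p.2 ≠ 0).card
      + (Finset.univ.filter fun i : Fin (layerDim d w (l + 1)) => N.b l i ≠ 0).card)

theorem ReLUNet.hidden_congr {L L' : ℕ} (N : ReLUNet d L w) (N' : ReLUNet d L' w) (ℓ : ℕ)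
    (hW : ∀ l < ℓ, N.W l = N'.W l) (hb : ∀ l < ℓ, N.b l = N'.b l) (x : Pt d) :
    N.hidden ℓ x = N'.hidden ℓ x := by
  induction ℓ with
  | zero => rfl
  | succ ℓ ih =>
    funext i
    simp only [ReLUNet.hidden]
    rw [ih (fun l hl => hW l (by omega)) (fun l hl => hb l (by omega)), hW ℓ (by omega),
      hb ℓ (by omega)]

theorem ReLUNet.weightCount_congr {L L' : ℕ} (N : ReLUNet d L w) (N' : ReLUNet d L' w) (ℓ : ℕ)
    (hW : ∀ l < ℓ, N.W l = N'.W l) (hb : ∀ l < ℓ, N.b l = N'.b l) :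
    N.weightCount ℓ = N'.weightCount ℓ := by
  unfold ReLUNet.weightCount
  refine Finset.sum_congr rfl fun l hl => ?_
  rw [hW l (Finset.mem_range.1 hl), hb l (Finset.mem_range.1 hl)]

/-- The functions `F i` are outputs of different units of hidden layer `ℓ` of some network with
at most `K` non-zero weights and biases up to this layer. -/
def IsHidden {ι : Type} (w : ℕ → ℕ) (ℓ K : ℕ) (F : ι → Pt d → ℝ) : Prop :=
  ∃ (N : ReLUNet d ℓ w) (e : ι ↪ Fin (layerDim d w ℓ)),
    (∀ x i, N.hidden ℓ x (e i) = F i x) ∧ N.weightCount ℓ ≤ K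

theorem isHidden_zero : IsHidden w 0 0 (fun (i : Fin d) (x : Pt d) => x i) :=
  ⟨⟨fun _ => 0, fun _ => 0, 0⟩, Function.Embedding.refl _, fun _ _ => rfl, by
    simp [ReLUNet.weightCount]⟩

theorem sum_extend_mul {ι κ : Type} [Fintype ι] [Fintype κ] (e : ι ↪ κ) (a : ι → ℝ) (h : κ → ℝ) :
    ∑ q, Function.extend e a 0 q * h q = ∑ i, a i * h (e i) := by
  classical
  rw [← Finset.sum_subset (Finset.subset_univ (Finset.univ.map e))]
  · rw [Finset.sum_map]
    exact Finset.sum_congr rfl fun i _ => by rw [e.injective.extend_apply]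
  · intro q _ hq
    rw [Function.extend_apply' _ _ _ (by simpa using hq)]
    simp

/-- Weights and biases of the surplus units are padded by zero, so they do not enter the count. Each
active unit costs its fan-in plus one bias, which is what keeps the total linear in `n`. -/
theorem IsHidden.step {ι κ : Type} [Fintype ι] [Fintype κ] {ℓ K : ℕ} {F : ι → Pt d → ℝ}
    (h : IsHidden w ℓ K F) (hw : Fintype.card κ ≤ w (ℓ + 1)) (A : κ → ι → ℝ) (b : κ → ℝ)
    (S : κ → Finset ι) (hA : ∀ k i, A k i ≠ 0 → i ∈ S k) (s : ℕ) (hs : ∀ k, (S k).card ≤ s) :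
    IsHidden w (ℓ + 1) (K + Fintype.card κ * (s + 1))
      (fun k x => max (∑ i, A k i * F i x + b k) 0) := by
  classical
  obtain ⟨N, e, hN, hK⟩ := h
  obtain ⟨e'⟩ : Nonempty (κ ↪ Fin (layerDim d w (ℓ + 1))) :=
    Function.Embedding.nonempty_of_card_le (hw.trans_eq (Fintype.card_fin _).symm)
  let W' : Matrix (Fin (layerDim d w (ℓ + 1))) (Fin (layerDim d w ℓ)) ℝ :=
    Function.extend e' (fun k => Function.extend e (A k) 0) 0
  let b' : Fin (layerDim d w (ℓ + 1)) → ℝ := Function.extend e' b 0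
  let N' : ReLUNet d (ℓ + 1) w := ⟨Function.update N.W ℓ W', Function.update N.b ℓ b', 0⟩
  have hW : ∀ l < ℓ, N'.W l = N.W l := fun l hl => Function.update_of_ne hl.ne _ _
  have hb : ∀ l < ℓ, N'.b l = N.b l := fun l hl => Function.update_of_ne hl.ne _ _
  have hWℓ : N'.W ℓ = W' := Function.update_self _ _ _
  have hbℓ : N'.b ℓ = b' := Function.update_self _ _ _
  refine ⟨N', e', fun x k => ?_, ?_⟩
  · simp only [ReLUNet.hidden]
    rw [hWℓ, hbℓ, ReLUNet.hidden_congr N' N ℓ hW hb]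
    have h1 : W' (e' k) = Function.extend e (A k) 0 := e'.injective.extend_apply _ _ _
    have h2 : b' (e' k) = b k := e'.injective.extend_apply _ _ _
    rw [h2, Matrix.mulVec, dotProduct, h1, sum_extend_mul]
    simp only [hN]
  · have hsum : N'.weightCount (ℓ + 1) = N.weightCount ℓ
        + ((Finset.univ.filter fun p : Fin (layerDim d w (ℓ + 1)) × Fin (layerDim d w ℓ) =>
          W' p.1 p.2 ≠ 0).card
        + (Finset.univ.filter fun i : Fin (layerDim d w (ℓ + 1)) => b' i ≠ 0).card) := by
      rw [← ReLUNet.weightCount_congr N' N ℓ hW hb, ← hWℓ, ← hbℓ]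
      simp only [ReLUNet.weightCount]
      rw [Finset.sum_range_succ]
    rw [hsum, mul_add, mul_one]
    refine add_le_add hK (add_le_add ?_ ?_)
    · refine (Finset.card_le_card (t := Finset.univ.biUnion fun k : κ =>
        (S k).image fun i => (e' k, e i)) ?_).trans
        (Finset.card_biUnion_le_card_mul _ _ _ fun k _ => Finset.card_image_le.trans (hs k))
      rintro ⟨p, q⟩ hpq
      have hne : W' p q ≠ 0 := (Finset.mem_filter.1 hpq).2
      by_cases hp : ∃ k, e' k = p
      · obtain ⟨k, rfl⟩ := hp
        have h1 : W' (e' k) = Function.extend e (A k) 0 := e'.injective.extend_apply _ _ _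
        rw [h1] at hne
        by_cases hq : ∃ i, e i = q
        · obtain ⟨i, rfl⟩ := hq
          rw [e.injective.extend_apply] at hne
          simp only [Finset.mem_biUnion, Finset.mem_univ, true_and, Finset.mem_image]
          exact ⟨k, i, hA k i hne, rfl⟩
        · rw [Function.extend_apply' _ _ _ hq] at hne
          exact absurd rfl hne
      · exact absurd (congrFun (Function.extend_apply' (f := e') _ _ _ hp) q) hne
    · refine (Finset.card_le_card (t := Finset.univ.image e') ?_).trans Finset.card_image_le
      intro p hp
      have hne : b' p ≠ 0 := (Finset.mem_filter.1 hp).2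
      by_contra hcon
      exact hne (Function.extend_apply' (f := e') _ _ _ fun ⟨k, hk⟩ => hcon (by simp [← hk]))

/-- The affine combinations of the functions `F i`. -/
def readout {ι : Type} (F : ι → Pt d → ℝ) : Submodule ℝ (Pt d → ℝ) :=
  Submodule.span ℝ (insert 1 (Set.range F))

theorem mem_readout_self {ι : Type} (F : ι → Pt d → ℝ) (i : ι) : F i ∈ readout F :=
  Submodule.subset_span (Set.mem_insert_of_mem _ ⟨i, rfl⟩)

theorem const_mem_readout {ι : Type} (F : ι → Pt d → ℝ) (c : ℝ) :
    (fun _ => c) ∈ readout F := by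
  have : (fun _ : Pt d => c) = c • (1 : Pt d → ℝ) := by
    funext x
    simp
  rw [this]
  exact Submodule.smul_mem _ _ (Submodule.subset_span (Set.mem_insert _ _))

theorem readout_le {ι κ : Type} {F : ι → Pt d → ℝ} {G : κ → Pt d → ℝ}
    (h : ∀ k, G k ∈ readout F) : readout G ≤ readout F := by
  refine Submodule.span_le.2 ?_
  rintro _ (rfl | ⟨k, rfl⟩)
  · exact const_mem_readout F 1
  · exact h k

theorem exists_eq_of_mem_readout {ι : Type} [Fintype ι] {F : ι → Pt d → ℝ} {f : Pt d → ℝ}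
    (h : f ∈ readout F) : ∃ (a : ι → ℝ) (b : ℝ), ∀ x, f x = ∑ i, a i * F i x + b := by
  obtain ⟨b, z, hz, rfl⟩ := Submodule.mem_span_insert.1 h
  obtain ⟨a, rfl⟩ := (Submodule.mem_span_range_iff_exists_fun ℝ).1 hz
  refine ⟨a, b, fun x => ?_⟩
  simp [Finset.sum_apply, add_comm]

/-- A sparse layer: each new unit reads only the units in `S k`. -/
theorem IsHidden.relu_sparse {ι κ : Type} [Fintype ι] [Fintype κ] {ℓ K : ℕ} {F : ι → Pt d → ℝ}
    (h : IsHidden w ℓ K F) (hw : Fintype.card κ ≤ w (ℓ + 1)) (G : κ → Pt d → ℝ)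
    (S : κ → Finset ι) (hG : ∀ k, G k ∈ readout (fun i : S k => F i))
    (s : ℕ) (hs : ∀ k, (S k).card ≤ s) :
    IsHidden w (ℓ + 1) (K + Fintype.card κ * (s + 1)) (fun k x => max (G k x) 0) := by
  classical
  choose a b hab using fun k => exists_eq_of_mem_readout (hG k)
  have key := h.step hw (fun k i => if hi : i ∈ S k then a k ⟨i, hi⟩ else 0) b S
    (fun k i hne => by
      by_contra hcon
      simp [hcon] at hne) s hs
  convert key using 4 with k x
  rw [hab]
  congr 1
  rw [← Finset.sum_subset (Finset.subset_univ (S k)) (fun i _ hi => by simp [hi]),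
    ← Finset.sum_coe_sort (S k)]
  exact Finset.sum_congr rfl fun i _ => by simp

theorem IsHidden.relu {ι κ : Type} [Fintype ι] [Fintype κ] {ℓ K U : ℕ} {F : ι → Pt d → ℝ}
    (h : IsHidden w ℓ K F) (hw : Fintype.card κ ≤ w (ℓ + 1)) (G : κ → Pt d → ℝ)
    (hG : ∀ k, G k ∈ readout F) (hU : Fintype.card ι ≤ U) :
    IsHidden w (ℓ + 1) (K + Fintype.card κ * (U + 1)) (fun k x => max (G k x) 0) := by
  refine h.relu_sparse hw G (fun _ => Finset.univ) (fun k => ?_) U (fun _ => by simpa using hU)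
  refine readout_le (fun i => ?_) (hG k)
  exact mem_readout_self (fun i : (Finset.univ : Finset ι) => F i) ⟨i, Finset.mem_univ i⟩

/-- The output map has no bias, so only linear combinations of units are available here; a constant
term must come from a unit. -/
theorem IsHidden.mem_sparseHypothesisSpace {ι : Type} [Fintype ι] {ℓ K : ℕ} {F : ι → Pt d → ℝ}
    (h : IsHidden w ℓ K F) (c : ι → ℝ) {R : ℝ} (hR : (K + Fintype.card ι : ℝ) ≤ R) :
    (fun x => ∑ i, c i * F i x) ∈ sparseHypothesisSpace d ℓ w R := by
  classical
  obtain ⟨N, e, hN, hK⟩ := h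
  let N' : ReLUNet d ℓ w := ⟨N.W, N.b, Function.extend e c 0⟩
  refine ⟨N', ?_, ?_⟩
  · refine le_trans ?_ hR
    have h1 : N'.numNonzero = N.weightCount ℓ
        + (Finset.univ.filter fun i => Function.extend e c 0 i ≠ 0).card := rfl
    have h2 : (Finset.univ.filter fun i => Function.extend e c 0 i ≠ 0).card
        ≤ Fintype.card ι := by
      refine (Finset.card_le_card (t := Finset.univ.image e) ?_).trans Finset.card_image_le
      intro p hp
      have hne := (Finset.mem_filter.1 hp).2
      by_contra hcon
      exact hne (Function.extend_apply' (f := e) _ _ _ fun ⟨k, hk⟩ => hcon (by simp [← hk]))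
    rw [h1]
    exact_mod_cast add_le_add hK h2
  · funext x
    have h3 : N'.hidden ℓ x = N.hidden ℓ x :=
      ReLUNet.hidden_congr N' N ℓ (fun _ _ => rfl) (fun _ _ => rfl) x
    simp only [ReLUNet.toFun, h3]
    rw [show N'.c = Function.extend e c 0 from rfl, sum_extend_mul]
    simp only [hN]

/-- The functions `V k` are affine combinations of at most `U` units of layer `ℓ` of a network
with at most `K` non-zero weights and biases up to this layer. -/
def IsReadable {κ : Type} (w : ℕ → ℕ) (U ℓ K : ℕ) (V : κ → Pt d → ℝ) : Prop :=
  ∃ (ι : Type) (_ : Fintype ι) (F : ι → Pt d → ℝ),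
    Fintype.card ι ≤ U ∧ IsHidden w ℓ K F ∧ ∀ k, V k ∈ readout F

theorem IsHidden.isReadable {ι : Type} [Fintype ι] {U ℓ K : ℕ} {F : ι → Pt d → ℝ}
    (h : IsHidden w ℓ K F) (hU : Fintype.card ι ≤ U) : IsReadable w U ℓ K F :=
  ⟨ι, inferInstance, F, hU, h, mem_readout_self F⟩

theorem IsReadable.map {κ κ' : Type} {U ℓ K : ℕ} {V : κ → Pt d → ℝ} {V' : κ' → Pt d → ℝ}
    (h : IsReadable w U ℓ K V) (hV : ∀ k, V' k ∈ readout V) : IsReadable w U ℓ K V' := by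
  obtain ⟨ι, _, F, hU, hF, hVF⟩ := h
  exact ⟨ι, inferInstance, F, hU, hF, fun k => readout_le hVF (hV k)⟩

theorem IsReadable.relu_isHidden {κ κ' : Type} [Fintype κ'] {U ℓ K : ℕ} {V : κ → Pt d → ℝ}
    (h : IsReadable w U ℓ K V) (hw : Fintype.card κ' ≤ w (ℓ + 1)) (G : κ' → Pt d → ℝ)
    (hG : ∀ k, G k ∈ readout V) :
    IsHidden w (ℓ + 1) (K + Fintype.card κ' * (U + 1)) (fun k x => max (G k x) 0) := by
  obtain ⟨ι, _, F, hU, hF, hVF⟩ := h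
  exact hF.relu hw G (fun k => readout_le hVF (hG k)) hU

theorem IsHidden.mono {ι : Type} {ℓ K K' : ℕ} {F : ι → Pt d → ℝ}
    (h : IsHidden w ℓ K F) (hK : K ≤ K') : IsHidden w ℓ K' F := by
  obtain ⟨N, e, hN, h'⟩ := h
  exact ⟨N, e, hN, h'.trans hK⟩

/-- A layer of at most `U` units. -/
theorem IsReadable.relu {κ κ' : Type} [Fintype κ'] {U ℓ K : ℕ} {V : κ → Pt d → ℝ}
    (h : IsReadable w U ℓ K V) (hU : Fintype.card κ' ≤ U) (hw : U ≤ w (ℓ + 1))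
    (G : κ' → Pt d → ℝ) (hG : ∀ k, G k ∈ readout V) :
    IsReadable w U (ℓ + 1) (K + U * (U + 1)) (fun k x => max (G k x) 0) :=
  ((h.relu_isHidden (hU.trans hw) G hG).mono (by gcongr)).isReadable hU

end Networks

/-! ### Approximate multiplication -/

section Multiplication

/-- The tent map. -/
def tent (t : ℝ) : ℝ := 2 * max t 0 - 4 * max (t - 1 / 2) 0

theorem tent_mem {t : ℝ} (ht : t ∈ Set.Icc (0 : ℝ) 1) : tent t ∈ Set.Icc (0 : ℝ) 1 := by
  obtain ⟨h0, h1⟩ := ht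
  unfold tent
  rw [max_eq_left h0]
  rcases le_total t (1 / 2) with h | h
  · rw [max_eq_right (by linarith)]
    constructor <;> linarith
  · rw [max_eq_left (by linarith)]
    constructor <;> linarith

theorem tent_iterate_mem {t : ℝ} (ht : t ∈ Set.Icc (0 : ℝ) 1) (m : ℕ) :
    tent^[m] t ∈ Set.Icc (0 : ℝ) 1 := by
  induction m with
  | zero => exact ht
  | succ m ih =>
    rw [Function.iterate_succ_apply']
    exact tent_mem ih

/-- Equivalent to (1 - 2g)² = (1 - tent g)². This makes the error of the square approximation
self-similar: each step replaces g by tent g and divides by 4. -/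
theorem tent_logistic {g : ℝ} (hg : g ∈ Set.Icc (0 : ℝ) 1) :
    4 * (g - g ^ 2) - tent g = tent g - tent g ^ 2 := by
  obtain ⟨h0, h1⟩ := hg
  unfold tent
  rw [max_eq_left h0]
  rcases le_total g (1 / 2) with h | h
  · rw [max_eq_right (by linarith)]
    ring
  · rw [max_eq_left (by linarith)]
    ring

/-- The piecewise linear interpolation of the square at the multiples of `2⁻ᵐ`. -/
def sqApprox : ℕ → ℝ → ℝ
  | 0, t => t
  | m + 1, t => sqApprox m t - (1 / 4 ^ (m + 1)) * tent^[m + 1] t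

theorem sqApprox_sub_sq {t : ℝ} (ht : t ∈ Set.Icc (0 : ℝ) 1) (m : ℕ) :
    sqApprox m t - t ^ 2 = (tent^[m] t - (tent^[m] t) ^ 2) / 4 ^ m := by
  induction m with
  | zero => simp [sqApprox]
  | succ m ih =>
    have h := tent_logistic (tent_iterate_mem ht m)
    simp only [sqApprox]
    rw [Function.iterate_succ_apply']
    have : sqApprox m t = t ^ 2 + (tent^[m] t - (tent^[m] t) ^ 2) / 4 ^ m := by linarith
    rw [this, ← h, pow_succ]
    field_simp
    ring

theorem sqApprox_bounds {t : ℝ} (ht : t ∈ Set.Icc (0 : ℝ) 1) (m : ℕ) :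
    t ^ 2 ≤ sqApprox m t ∧ sqApprox m t ≤ t ^ 2 + 1 / (4 * 4 ^ m) := by
  have h := sqApprox_sub_sq ht m
  obtain ⟨h0, h1⟩ := tent_iterate_mem ht m
  have hp : (0 : ℝ) < 4 ^ m := by positivity
  have h2 : 0 ≤ (tent^[m] t - (tent^[m] t) ^ 2) / 4 ^ m := div_nonneg (by nlinarith) hp.le
  have h3 : (tent^[m] t - (tent^[m] t) ^ 2) / 4 ^ m ≤ 1 / (4 * 4 ^ m) := by
    rw [div_le_div_iff₀ hp (by positivity)]
    nlinarith [sq_nonneg (tent^[m] t - 1 / 2)]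
  constructor <;> linarith

theorem sqApprox_nonneg {t : ℝ} (ht : t ∈ Set.Icc (0 : ℝ) 1) (m : ℕ) : 0 ≤ sqApprox m t :=
  (sq_nonneg t).trans (sqApprox_bounds ht m).1

/-- Projection onto `[0, 1]`. -/
def clip (t : ℝ) : ℝ := max t 0 - max (t - 1) 0

theorem clip_mem (t : ℝ) : clip t ∈ Set.Icc (0 : ℝ) 1 := by
  unfold clip
  rcases le_total t 0 with h | h
  · rw [max_eq_right h, max_eq_right (by linarith)]
    norm_num
  · rw [max_eq_left h]
    rcases le_total t 1 with h' | h'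
    · rw [max_eq_right (by linarith)]
      constructor <;> linarith
    · rw [max_eq_left (by linarith)]
      constructor <;> linarith

theorem clip_of_mem {t : ℝ} (ht : t ∈ Set.Icc (0 : ℝ) 1) : clip t = t := by
  unfold clip
  rw [max_eq_left ht.1, max_eq_right (by linarith [ht.2])]
  ring

theorem abs_clip_sub_le {s t : ℝ} (ht : t ∈ Set.Icc (0 : ℝ) 1) : |clip s - t| ≤ |s - t| := by
  obtain ⟨h0, h1⟩ := ht
  unfold clip
  rcases le_total s 0 with h | h
  · rw [max_eq_right h, max_eq_right (by linarith), abs_of_nonpos (by linarith),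
      abs_of_nonpos (by linarith)]
    linarith
  · rw [max_eq_left h]
    rcases le_total s 1 with h' | h'
    · rw [max_eq_right (by linarith)]
      simp
    · rw [max_eq_left (by linarith), abs_of_nonneg (by linarith), abs_of_nonneg (by linarith)]
      linarith

/-- Approximate multiplication on `[0, 1]`, by polarization. -/
def mulApprox (m : ℕ) (a b : ℝ) : ℝ :=
  clip (2 * sqApprox m ((a + b) / 2) - (1 / 2) * sqApprox m a - (1 / 2) * sqApprox m b)

/-- Uses ab = 2((a+b)/2)² - a²/2 - b²/2 with three square errors in [0, 4^(-m)/4]. Clipping does not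
increase the error and keeps the value in [0, 1], so that products can be iterated. -/
theorem abs_mulApprox_sub_le {a b : ℝ} (ha : a ∈ Set.Icc (0 : ℝ) 1) (hb : b ∈ Set.Icc (0 : ℝ) 1)
    (m : ℕ) : |mulApprox m a b - a * b| ≤ 1 / 4 ^ m := by
  have hab : (a + b) / 2 ∈ Set.Icc (0 : ℝ) 1 := by
    constructor <;> linarith [ha.1, ha.2, hb.1, hb.2]
  refine (abs_clip_sub_le ⟨mul_nonneg ha.1 hb.1, mul_le_one₀ ha.2 hb.1 hb.2⟩).trans ?_
  obtain ⟨l1, u1⟩ := sqApprox_bounds ha m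
  obtain ⟨l2, u2⟩ := sqApprox_bounds hb m
  obtain ⟨l3, u3⟩ := sqApprox_bounds hab m
  have hp : (0 : ℝ) < 1 / 4 ^ m := by positivity
  have he : (1 : ℝ) / (4 * 4 ^ m) = (1 / 4) * (1 / 4 ^ m) := by
    field_simp
  rw [he] at u1 u2 u3
  rw [abs_le]
  constructor <;> nlinarith

theorem measurable_tent : Measurable tent := by
  unfold tent
  fun_prop

theorem measurable_sqApprox (m : ℕ) : Measurable (sqApprox m) := by
  induction m with
  | zero => exact measurable_id
  | succ m ih =>
    have := measurable_tent.iterate (m + 1)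
    exact ih.sub (this.const_mul _)

theorem measurable_clip : Measurable clip := by
  unfold clip
  fun_prop

end Multiplication

/-! ### Layers that compute squares and products -/

section Blocks

variable {d : ℕ} {w : ℕ → ℕ} {γ κ : Type}

/-- One refinement step of the square approximations; nonnegative functions are passed on. -/
theorem IsReadable.tent_step [Fintype γ] [Fintype κ] {U ℓ K : ℕ} {G : γ → Pt d → ℝ}
    {g f : κ → Pt d → ℝ} (h : IsReadable w U ℓ K (Sum.elim G (Sum.elim g f)))
    (hU : Fintype.card γ + 3 * Fintype.card κ ≤ U) (hw : U ≤ w (ℓ + 1))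
    (hG : ∀ k x, 0 ≤ G k x) (hf : ∀ k x, 0 ≤ f k x) (c : ℝ) :
    IsReadable w U (ℓ + 1) (K + U * (U + 1))
      (Sum.elim G (Sum.elim (fun k x => tent (g k x)) (fun k x => f k x - c * tent (g k x)))) := by
  -- Three units per approximated square: two for the tent map and one for the running
  -- approximation. A nonnegative function passes through a ReLU unchanged, so each carried function
  -- costs one unit.
  have h' := h.relu (κ' := γ ⊕ (κ ⊕ (κ ⊕ κ))) (by simp only [Fintype.card_sum]; omega) hw
    (Sum.elim G (Sum.elim g (Sum.elim (fun k x => g k x - 1 / 2) f))) (by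
      rintro (k | k | k | k)
      · exact mem_readout_self _ (Sum.inl k)
      · exact mem_readout_self _ (Sum.inr (Sum.inl k))
      · exact Submodule.sub_mem _ (mem_readout_self _ (Sum.inr (Sum.inl k)))
          (const_mem_readout _ _)
      · exact mem_readout_self _ (Sum.inr (Sum.inr k)))
  refine h'.map ?_
  set V := fun (k : γ ⊕ (κ ⊕ (κ ⊕ κ))) x =>
    max ((Sum.elim G (Sum.elim g (Sum.elim (fun k x => g k x - 1 / 2) f))) k x) 0 with hV
  have ht : ∀ k, (fun x => tent (g k x)) ∈ readout V := fun k =>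
    Submodule.sub_mem _
      (Submodule.smul_mem _ 2 (mem_readout_self V (Sum.inr (Sum.inl k))))
      (Submodule.smul_mem _ 4 (mem_readout_self V (Sum.inr (Sum.inr (Sum.inl k)))))
  rintro (k | k | k)
  · have : G k = V (Sum.inl k) := by
      funext x
      simp [hV, hG]
    rw [Sum.elim_inl, this]
    exact mem_readout_self V (Sum.inl k)
  · exact ht k
  · have : f k = V (Sum.inr (Sum.inr (Sum.inr k))) := by
      funext x
      simp [hV, hf]
    have hfk : f k ∈ readout V := this ▸ mem_readout_self V _
    exact Submodule.sub_mem _ hfk (Submodule.smul_mem _ c (ht k))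

theorem IsReadable.sqApprox [Fintype γ] [Fintype κ] {U ℓ K : ℕ} {G : γ → Pt d → ℝ}
    {V : κ → Pt d → ℝ} (h : IsReadable w U ℓ K (Sum.elim G V))
    (hU : Fintype.card γ + 3 * Fintype.card κ ≤ U) (hw : ∀ l > ℓ, U ≤ w l)
    (hG : ∀ k x, 0 ≤ G k x) (hV : ∀ k x, V k x ∈ Set.Icc (0 : ℝ) 1) (m : ℕ) :
    IsReadable w U (ℓ + m) (K + m * (U * (U + 1)))
      (Sum.elim G (Sum.elim (fun k x => tent^[m] (V k x)) (fun k x => sqApprox m (V k x)))) := by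
  induction m with
  | zero =>
    have := h.map (V' := Sum.elim G (Sum.elim V V)) (by
      rintro (k | k | k)
      · exact mem_readout_self _ (Sum.inl k)
      · exact mem_readout_self _ (Sum.inr k)
      · exact mem_readout_self _ (Sum.inr k))
    simpa [AdvTrain.sqApprox] using this
  | succ m ih =>
    have := ih.tent_step hU (hw _ (by omega)) hG (fun k x => sqApprox_nonneg (hV k x) m)
      (1 / 4 ^ (m + 1))
    simp only [← Function.iterate_succ_apply' tent] at this
    have e : K + (m + 1) * (U * (U + 1)) = K + m * (U * (U + 1)) + U * (U + 1) := by ring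
    rw [e]
    exact this

/-- Approximate multiplication of values `P (π k)` by values `Q k` read from `G`. -/
theorem IsReadable.mulApprox {I J : Type} [Fintype γ] [Fintype J] {U ℓ K : ℕ}
    {G : γ → Pt d → ℝ} {P : I → Pt d → ℝ} (h : IsReadable w U ℓ K (Sum.elim G P))
    (hU : Fintype.card γ + 9 * Fintype.card J ≤ U) (hw : ∀ l > ℓ, U ≤ w l)
    (hG : ∀ k x, 0 ≤ G k x) (hP : ∀ k x, P k x ∈ Set.Icc (0 : ℝ) 1)
    (π : J → I) (Q : J → Pt d → ℝ) (hQG : ∀ k, Q k ∈ readout G)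
    (hQ : ∀ k x, Q k x ∈ Set.Icc (0 : ℝ) 1) (m : ℕ) :
    IsReadable w U (ℓ + (m + 1)) (K + (m + 1) * (U * (U + 1)))
      (Sum.elim G (fun k x => mulApprox m (P (π k) x) (Q k x))) := by
  have hle : readout G ≤ readout (Sum.elim G P) := readout_le fun k => mem_readout_self _ (Sum.inl k)
  have h1 := h.map (V' := Sum.elim G (Sum.elim (fun k x => (P (π k) x + Q k x) / 2)
      (Sum.elim (fun k => P (π k)) Q))) (by
    have hPm : ∀ k, P (π k) ∈ readout (Sum.elim G P) := fun k =>
      mem_readout_self (Sum.elim G P) (Sum.inr (π k))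
    rintro (k | k | k | k)
    · exact mem_readout_self _ (Sum.inl k)
    · have : (fun x => (P (π k) x + Q k x) / 2) = (1 / 2 : ℝ) • (P (π k) + Q k) := by
        funext x
        simp only [Pi.smul_apply, Pi.add_apply, smul_eq_mul]
        ring
      simp only [Sum.elim_inr, Sum.elim_inl]
      rw [this]
      exact Submodule.smul_mem _ _ (Submodule.add_mem _ (hPm k) (hle (hQG k)))
    · exact hPm k
    · exact hle (hQG k))
  -- Three squares per product at three units each: this is the 9 in the width bound.
  have h2 := h1.sqApprox (by simp only [Fintype.card_sum]; omega) hw hG (by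
    rintro (k | k | k) x
    · have h1 := hP (π k) x
      have h2 := hQ k x
      simp only [Sum.elim_inl]
      constructor <;> linarith [h1.1, h1.2, h2.1, h2.2]
    · exact hP _ _
    · exact hQ _ _) m
  set W := (Sum.elim G (Sum.elim
    (fun k x => tent^[m] ((Sum.elim (fun k x => (P (π k) x + Q k x) / 2)
      (Sum.elim (fun k => P (π k)) Q)) k x))
    (fun k x => AdvTrain.sqApprox m ((Sum.elim (fun k x => (P (π k) x + Q k x) / 2)
      (Sum.elim (fun k => P (π k)) Q)) k x)))) with hW
  let Z : J → Pt d → ℝ := fun k x => 2 * AdvTrain.sqApprox m ((P (π k) x + Q k x) / 2)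
    - (1 / 2) * AdvTrain.sqApprox m (P (π k) x) - (1 / 2) * AdvTrain.sqApprox m (Q k x)
  have hZ : ∀ k, Z k ∈ readout W := fun k =>
    Submodule.sub_mem _ (Submodule.sub_mem _
      (Submodule.smul_mem _ 2 (mem_readout_self W (Sum.inr (Sum.inr (Sum.inl k)))))
      (Submodule.smul_mem _ (1 / 2) (mem_readout_self W (Sum.inr (Sum.inr (Sum.inr (Sum.inl k)))))))
      (Submodule.smul_mem _ (1 / 2) (mem_readout_self W (Sum.inr (Sum.inr (Sum.inr (Sum.inr k))))))
  have h3 := h2.relu (κ' := γ ⊕ (J ⊕ J)) (by simp only [Fintype.card_sum]; omega)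
    (hw _ (by omega)) (Sum.elim G (Sum.elim Z (fun k x => Z k x - 1))) (by
      rintro (k | k | k)
      · exact mem_readout_self W (Sum.inl k)
      · exact hZ k
      · exact Submodule.sub_mem _ (hZ k) (const_mem_readout _ _))
  have e : K + (m + 1) * (U * (U + 1)) = K + m * (U * (U + 1)) + U * (U + 1) := by ring
  rw [e]
  refine h3.map ?_
  set R := fun (k : γ ⊕ (J ⊕ J)) x => max (Sum.elim G (Sum.elim Z (fun k x => Z k x - 1)) k x) 0
    with hR
  rintro (k | k)
  · have : G k = R (Sum.inl k) := by
      funext x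
      simp [hR, hG]
    rw [Sum.elim_inl, this]
    exact mem_readout_self R (Sum.inl k)
  · exact Submodule.sub_mem _ (mem_readout_self R (Sum.inr (Sum.inl k)))
      (mem_readout_self R (Sum.inr (Sum.inr k)))

end Blocks

/-! ### Monomials on the unit cube -/

section Monomials

variable {d : ℕ} {w : ℕ → ℕ}

/-- The coordinates, completed by the constant `1`. -/
def coord (x : Pt d) : Option (Fin d) → ℝ
  | none => 1
  | some j => x j

/-- Coordinatewise projection onto the unit cube. -/
def clipPt (x : Pt d) : Pt d := fun j => clip (x j)

theorem clipPt_mem (x : Pt d) : clipPt x ∈ cube d :=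
  ⟨fun j => (clip_mem (x j)).1, fun j => (clip_mem (x j)).2⟩

theorem clipPt_of_mem {x : Pt d} (hx : x ∈ cube d) : clipPt x = x :=
  funext fun j => clip_of_mem ⟨hx.1 j, hx.2 j⟩

theorem coord_mem {x : Pt d} (hx : x ∈ cube d) (j : Option (Fin d)) :
    coord x j ∈ Set.Icc (0 : ℝ) 1 := by
  cases j with
  | none => simp [coord]
  | some j => exact ⟨hx.1 j, hx.2 j⟩

/-- Network approximation of the monomial `∏ i, coord x (τ i)` on the unit cube. -/
def monoApprox (m : ℕ) : (D : ℕ) → (Fin D → Option (Fin d)) → Pt d → ℝ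
  | 0, _, _ => 1
  | D + 1, τ, x => mulApprox m (monoApprox m D (Fin.tail τ) x) (coord (clipPt x) (τ 0))

theorem monoApprox_mem (m D : ℕ) (τ : Fin D → Option (Fin d)) (x : Pt d) :
    monoApprox m D τ x ∈ Set.Icc (0 : ℝ) 1 := by
  cases D with
  | zero => simp [monoApprox]
  | succ D => exact clip_mem _

/-- Every factor lies in [0, 1], so the error of the previous product is not amplified, and each
multiplication adds at most 4^(-m). -/
theorem abs_monoApprox_sub_le (m D : ℕ) (τ : Fin D → Option (Fin d)) {x : Pt d}
    (hx : x ∈ cube d) : |monoApprox m D τ x - ∏ i, coord x (τ i)| ≤ D * (1 / 4 ^ m) := by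
  induction D with
  | zero => simp [monoApprox]
  | succ D ih =>
    have h1 := ih (Fin.tail τ)
    have hc := coord_mem hx (τ 0)
    have h2 := abs_mulApprox_sub_le (monoApprox_mem m D (Fin.tail τ) x) hc m
    rw [Fin.prod_univ_succ]
    simp only [monoApprox, clipPt_of_mem hx]
    have h3 : |monoApprox m D (Fin.tail τ) x * coord x (τ 0)
        - coord x (τ 0) * ∏ i : Fin D, coord x (τ i.succ)| ≤ D * (1 / 4 ^ m) := by
      rw [mul_comm, ← mul_sub, abs_mul, abs_of_nonneg hc.1]
      exact (mul_le_of_le_one_left (abs_nonneg _) hc.2).trans h1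
    have h4 := abs_sub_le (mulApprox m (monoApprox m D (Fin.tail τ) x) (coord x (τ 0)))
      (monoApprox m D (Fin.tail τ) x * coord x (τ 0))
      (coord x (τ 0) * ∏ i : Fin D, coord x (τ i.succ))
    push_cast
    linarith

theorem measurable_monoApprox (m D : ℕ) (τ : Fin D → Option (Fin d)) :
    Measurable (monoApprox m D τ) := by
  induction D with
  | zero => exact measurable_const
  | succ D ih =>
    have h1 := ih (Fin.tail τ)
    have h2 : Measurable fun x : Pt d => coord (clipPt x) (τ 0) := by
      cases τ 0 with
      | none => exact measurable_const
      | some j => exact measurable_clip.comp (measurable_pi_apply j)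
    have hs := measurable_sqApprox m
    exact measurable_clip.comp (((hs.comp ((h1.add h2).div_const 2)).const_mul 2).sub
      ((hs.comp h1).const_mul _) |>.sub ((hs.comp h2).const_mul _))

/-- All monomials of one degree are computed in parallel, each from its tail by a single product.
The clipped coordinates stay available in `G`, which is carried along. -/
theorem IsReadable.monoApprox {γ : Type} [Fintype γ] {U ℓ K : ℕ} {G : γ → Pt d → ℝ}
    (h : IsReadable w U ℓ K G) (m D : ℕ)
    (hU : Fintype.card γ + 9 * (d + 1) ^ D ≤ U) (hw : ∀ l > ℓ, U ≤ w l)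
    (hG : ∀ k x, 0 ≤ G k x) (hz : ∀ j : Fin d, (fun x => clip (x j)) ∈ readout G) :
    IsReadable w U (ℓ + D * (m + 1)) (K + D * (m + 1) * (U * (U + 1)))
      (Sum.elim G (AdvTrain.monoApprox m D)) := by
  suffices H : ∀ t ≤ D, IsReadable w U (ℓ + t * (m + 1)) (K + t * (m + 1) * (U * (U + 1)))
      (Sum.elim G (AdvTrain.monoApprox m t)) from H D le_rfl
  intro t ht
  induction t with
  | zero =>
    have : IsReadable w U ℓ K (Sum.elim G (AdvTrain.monoApprox (d := d) m 0)) := h.map (by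
      rintro (k | k)
      · exact mem_readout_self _ k
      · exact const_mem_readout _ 1)
    simpa using this
  | succ t ih =>
    have h1 := (ih (by omega)).mulApprox (J := Fin (t + 1) → Option (Fin d)) (by
        refine le_trans ?_ hU
        simp only [Fintype.card_fun, Fintype.card_option, Fintype.card_fin]
        gcongr
        omega) (fun l hl => hw l (by
          have := Nat.zero_le (t * (m + 1))
          omega)) hG (monoApprox_mem m t) Fin.tail (fun τ x => coord (clipPt x) (τ 0))
        (fun τ => by
          cases τ 0 with
          | none => exact const_mem_readout _ 1
          | some j => exact hz j)
        (fun τ x => coord_mem (clipPt_mem x) _) m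
    have e1 : ℓ + (t + 1) * (m + 1) = ℓ + t * (m + 1) + (m + 1) := by ring
    have e2 : K + (t + 1) * (m + 1) * (U * (U + 1))
      = K + t * (m + 1) * (U * (U + 1)) + (m + 1) * (U * (U + 1)) := by ring
    rw [e1, e2]
    exact h1

end Monomials

/-! ### Taylor polynomials as combinations of monomials -/

section Taylor

/-- The derivative of the remainder is the remainder of order one lower, and the remainder vanishes
at 0, so the mean value inequality on [0, 1] preserves the bound. The factorial gain is not needed.
-/
theorem abs_sub_taylor_le (r : ℕ) (φ : ℕ → ℝ → ℝ) (Λ : ℝ)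
    (hφ : ∀ k < r, ∀ t ∈ Set.Icc (0 : ℝ) 1,
      HasDerivWithinAt (φ k) (φ (k + 1) t) (Set.Icc 0 1) t)
    (hΛ : ∀ t ∈ Set.Icc (0 : ℝ) 1, |φ r t - φ r 0| ≤ Λ) :
    ∀ t ∈ Set.Icc (0 : ℝ) 1,
      |φ 0 t - ∑ k ∈ Finset.range (r + 1), φ k 0 * (t ^ k / k.factorial)| ≤ Λ := by
  induction r generalizing φ with
  | zero => simpa using hΛ
  | succ r ih =>
    intro t ht
    have h1 := ih (fun k => φ (k + 1)) (fun k hk => hφ (k + 1) (by omega)) hΛ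
    have hderiv : ∀ s ∈ Set.Icc (0 : ℝ) 1, HasDerivWithinAt
        (fun t => φ 0 t - ∑ k ∈ Finset.range (r + 1 + 1), φ k 0 * (t ^ k / k.factorial))
        (φ 1 s - ∑ k ∈ Finset.range (r + 1), φ (k + 1) 0 * (s ^ k / k.factorial))
        (Set.Icc 0 1) s := by
      intro s hs
      refine (hφ 0 (by omega) s hs).sub ?_
      have h2 : ∀ k ∈ Finset.range (r + 1), HasDerivWithinAt
          (fun t : ℝ => φ (k + 1) 0 * (t ^ (k + 1) / (k + 1).factorial))
          (φ (k + 1) 0 * (s ^ k / k.factorial)) (Set.Icc 0 1) s := by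
        intro k _
        have h3 := ((hasDerivAt_pow (k + 1) s).div_const ((k + 1).factorial : ℝ)).const_mul
          (φ (k + 1) 0)
        refine (h3.congr_deriv ?_).hasDerivWithinAt
        rw [Nat.factorial_succ]
        push_cast
        have : (k.factorial : ℝ) ≠ 0 := by positivity
        have : (k : ℝ) + 1 ≠ 0 := by positivity
        field_simp
      have h4 := (HasDerivWithinAt.fun_sum h2).add_const (φ 0 0 * 1)
      refine h4.congr_of_mem (fun t _ => ?_) hs
      rw [Finset.sum_range_succ']
      simp
    have h5 := Convex.norm_image_sub_le_of_norm_hasDerivWithin_le hderiv (fun s hs => h1 s hs)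
      (convex_Icc 0 1) (Set.left_mem_Icc.2 zero_le_one) ht
    have h6 : φ 0 0 - ∑ k ∈ Finset.range (r + 1 + 1), φ k 0 * ((0 : ℝ) ^ k / k.factorial) = 0 := by
      rw [Finset.sum_range_succ']
      simp
    rw [h6, sub_zero, sub_zero, Real.norm_eq_abs, Real.norm_eq_abs, abs_of_nonneg ht.1] at h5
    have h7 : 0 ≤ Λ := (abs_nonneg _).trans (hΛ t ht)
    exact h5.trans (mul_le_of_le_one_right h7 ht.2)

variable {d : ℕ}

theorem convex_cube : Convex ℝ (cube d) := convex_Icc _ _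

theorem uniqueDiffOn_cube : UniqueDiffOn ℝ (cube d) := by
  have h : cube d = Set.univ.pi fun _ : Fin d => Set.Icc (0 : ℝ) 1 :=
    (Set.pi_univ_Icc _ _).symm
  rw [h]
  exact UniqueDiffOn.univ_pi fun _ => uniqueDiffOn_Icc_zero_one

/-- The Taylor polynomial of order `r` on the cube. -/
def taylorPoly (F : Pt d → ℝ) (r : ℕ) (c x : Pt d) : ℝ :=
  ∑ k ∈ Finset.range (r + 1),
    iteratedFDerivWithin ℝ k F (cube d) c (fun _ => x - c) * (1 / k.factorial)

theorem abs_sub_taylorPoly_le {F : Pt d → ℝ} {r : ℕ} {B : ℝ}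
    (hF : ContDiffOn ℝ (r : WithTop ℕ∞) F (cube d)) (hB : 0 ≤ B)
    (hLip : ∀ x ∈ cube d, ∀ y ∈ cube d,
      ‖iteratedFDerivWithin ℝ r F (cube d) x - iteratedFDerivWithin ℝ r F (cube d) y‖
        ≤ B * dist x y) {c x : Pt d} (hc : c ∈ cube d) (hx : x ∈ cube d) :
    |F x - taylorPoly F r c x| ≤ B * dist x c ^ (r + 1) := by
  set v := x - c with hv
  have hline : ∀ t ∈ Set.Icc (0 : ℝ) 1, c + t • v ∈ cube d := fun t ht =>
    convex_cube.add_smul_sub_mem hc hx ht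
  have hdist : dist x c = ‖v‖ := dist_eq_norm x c
  have hLd : ∀ t, HasDerivWithinAt (fun t : ℝ => c + t • v) v (Set.Icc 0 1) t := by
    intro t
    simpa using (((hasDerivAt_id t).smul_const v).const_add c).hasDerivWithinAt
  -- Restrict to the segment from c to x. The Lipschitz bound on the top derivative, applied to r
  -- copies of x - c, supplies the last of the r + 1 powers of the distance.
  have key := abs_sub_taylor_le r
    (fun k t => iteratedFDerivWithin ℝ k F (cube d) (c + t • v) (fun _ => v))
    (B * dist x c ^ (r + 1)) ?_ ?_ 1 (Set.right_mem_Icc.2 zero_le_one)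
  · have e : c + (1 : ℝ) • v = x := by
      rw [hv]
      simp
    simp only [e, one_pow, zero_smul, add_zero, iteratedFDerivWithin_zero_apply] at key
    exact key
  · intro k hk t ht
    have h1 : DifferentiableWithinAt ℝ (iteratedFDerivWithin ℝ k F (cube d)) (cube d)
        (c + t • v) :=
      hF.differentiableOn_iteratedFDerivWithin (by exact_mod_cast hk) uniqueDiffOn_cube _
        (hline t ht)
    have h2 := h1.hasFDerivWithinAt.comp_hasDerivWithinAt t (hLd t) hline
    have h3 := (ContinuousMultilinearMap.apply ℝ (fun _ : Fin k => Pt d) ℝ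
      (fun _ => v)).hasFDerivAt.comp_hasDerivWithinAt t h2
    rw [iteratedFDerivWithin_succ_apply_left]
    exact h3
  · intro t ht
    have h1 := hLip _ (hline t ht) c hc
    have h2 := (iteratedFDerivWithin ℝ r F (cube d) (c + t • v)
      - iteratedFDerivWithin ℝ r F (cube d) c).le_opNorm (fun _ => v)
    have h3 : dist (c + t • v) c ≤ ‖v‖ := by
      rw [dist_eq_norm, add_sub_cancel_left, norm_smul, Real.norm_eq_abs, abs_of_nonneg ht.1]
      exact mul_le_of_le_one_left (norm_nonneg _) ht.2
    simp only [Finset.prod_const, Finset.card_univ, Fintype.card_fin] at h2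
    simp only [zero_smul, add_zero, hdist]
    rw [← Real.norm_eq_abs]
    refine h2.trans ?_
    rw [pow_succ', ← mul_assoc]
    gcongr
    exact h1.trans (by gcongr)

/-- `p` is a combination of monomials of degree at most `D`, with coefficients of sum at most
`R` in absolute value. -/
def IsPoly (D : ℕ) (R : ℝ) (p : Pt d → ℝ) : Prop :=
  ∃ a : (Fin D → Option (Fin d)) → ℝ,
    ∑ τ, |a τ| ≤ R ∧ ∀ x, p x = ∑ τ, a τ * ∏ i, coord x (τ i)

theorem IsPoly.mono {D : ℕ} {R R' : ℝ} {p : Pt d → ℝ} (h : IsPoly D R p) (hR : R ≤ R') :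
    IsPoly D R' p := by
  obtain ⟨a, h1, h2⟩ := h
  exact ⟨a, h1.trans hR, h2⟩

theorem isPoly_const (a : ℝ) : IsPoly 0 |a| (fun _ : Pt d => a) :=
  ⟨fun _ => a, by simp, by simp⟩

theorem isPoly_zero (D : ℕ) : IsPoly D 0 (fun _ : Pt d => 0) :=
  ⟨0, by simp, by simp⟩

theorem IsPoly.add {D : ℕ} {R S : ℝ} {p q : Pt d → ℝ} (hp : IsPoly D R p) (hq : IsPoly D S q) :
    IsPoly D (R + S) (fun x => p x + q x) := by
  obtain ⟨a, h1, h2⟩ := hp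
  obtain ⟨b, h3, h4⟩ := hq
  refine ⟨fun τ => a τ + b τ, ?_, fun x => ?_⟩
  · refine (Finset.sum_le_sum fun τ _ => abs_add_le (a τ) (b τ)).trans ?_
    rw [Finset.sum_add_distrib]
    exact add_le_add h1 h3
  · simp only [h2, h4]
    rw [← Finset.sum_add_distrib]
    exact Finset.sum_congr rfl fun τ _ => by ring

theorem IsPoly.const_mul {D : ℕ} {R : ℝ} {p : Pt d → ℝ} (hp : IsPoly D R p) (c : ℝ) :
    IsPoly D (|c| * R) (fun x => c * p x) := by
  obtain ⟨a, h1, h2⟩ := hp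
  refine ⟨fun τ => c * a τ, ?_, fun x => ?_⟩
  · simp only [abs_mul, ← Finset.mul_sum]
    gcongr
  · simp only [h2, Finset.mul_sum]
    exact Finset.sum_congr rfl fun τ _ => by ring

theorem isPoly_sum {D : ℕ} {ι : Type*} (s : Finset ι) (R : ι → ℝ) (p : ι → Pt d → ℝ)
    (h : ∀ i ∈ s, IsPoly D (R i) (p i)) : IsPoly D (∑ i ∈ s, R i) (fun x => ∑ i ∈ s, p i x) := by
  classical
  induction s using Finset.induction_on with
  | empty => simpa using isPoly_zero D
  | insert i s hi ih =>
    simp only [Finset.sum_insert hi]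
    exact (h i (Finset.mem_insert_self i s)).add
      (ih fun j hj => h j (Finset.mem_insert_of_mem hj))

theorem IsPoly.coord_mul {D : ℕ} {R : ℝ} {p : Pt d → ℝ} (hp : IsPoly D R p)
    (j : Option (Fin d)) : IsPoly (D + 1) R (fun x => coord x j * p x) := by
  classical
  obtain ⟨a, h1, h2⟩ := hp
  refine ⟨fun τ => if τ 0 = j then a (Fin.tail τ) else 0, ?_, fun x => ?_⟩
  · rw [← (Fin.consEquiv fun _ => Option (Fin d)).sum_comp, Fintype.sum_prod_type,
      Finset.sum_eq_single j]
    · simpa [Fin.consEquiv] using h1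
    · intro b _ hb
      simp [Fin.consEquiv, hb]
    · simp
  · rw [← (Fin.consEquiv fun _ => Option (Fin d)).sum_comp, Fintype.sum_prod_type,
      Finset.sum_eq_single j]
    · simp only [h2, Finset.mul_sum]
      refine Finset.sum_congr rfl fun τ _ => ?_
      simp [Fin.consEquiv, Fin.prod_univ_succ]
      ring
    · intro b _ hb
      simp [Fin.consEquiv, hb]
    · simp

/-- Multiplying by the extra coordinate 1 raises the formal degree without changing the function. -/
theorem IsPoly.degree_mono {D D' : ℕ} {R : ℝ} {p : Pt d → ℝ} (hp : IsPoly D R p) (h : D ≤ D') :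
    IsPoly D' R p := by
  induction h with
  | refl => exact hp
  | step _ ih => simpa [coord] using ih.coord_mul none

theorem IsPoly.coord_sub_mul {D : ℕ} {R : ℝ} {p : Pt d → ℝ} (hp : IsPoly D R p) {c : Pt d}
    (hc : c ∈ cube d) (j : Fin d) (hR : 0 ≤ R) :
    IsPoly (D + 1) (2 * R) (fun x => (x j - c j) * p x) := by
  have h := (hp.coord_mul (some j)).add ((hp.coord_mul none).const_mul (-c j))
  have h2 : |(-c j)| ≤ 1 := by
    rw [abs_neg, abs_of_nonneg (hc.1 j)]
    exact hc.2 j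
  refine IsPoly.mono (R := R + |(-c j)| * R) ?_ (by nlinarith)
  convert h using 2 with x
  simp only [coord]
  ring

theorem isPoly_prod_coord_sub {c : Pt d} (hc : c ∈ cube d) {k : ℕ} (σ : Fin k → Fin d) :
    IsPoly k (2 ^ k) (fun x => ∏ i, (x (σ i) - c (σ i))) := by
  induction k with
  | zero => simpa using isPoly_const (d := d) 1
  | succ k ih =>
    have h := (ih (Fin.tail σ)).coord_sub_mul hc (σ 0) (by positivity)
    rw [pow_succ']
    simpa [Fin.prod_univ_succ, Fin.tail] using h

/-- Expanding in the standard basis gives d^k terms. The basis vectors have sup norm at most 1, so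
each coefficient is at most ‖A‖, and each product of k factors x_j - c_j contributes 2^k. -/
theorem isPoly_multilinear {c : Pt d} (hc : c ∈ cube d) {k : ℕ} {B : ℝ}
    (A : ContinuousMultilinearMap ℝ (fun _ : Fin k => Pt d) ℝ) (hA : ‖A‖ ≤ B) :
    IsPoly k (d ^ k * (B * 2 ^ k)) (fun x => A fun _ => x - c) := by
  classical
  have hexp : ∀ x : Pt d, (A fun _ => x - c) = ∑ σ : Fin k → Fin d,
      A (fun i => Pi.single (σ i) (1 : ℝ)) * ∏ i, (x (σ i) - c (σ i)) := by
    intro x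
    have h1 : (fun _ : Fin k => x - c)
        = fun _ => ∑ j : Fin d, (x j - c j) • (Pi.single j (1 : ℝ) : Pt d) := by
      funext _ j'
      simp [Finset.sum_apply, Pi.single_apply]
    rw [h1, A.map_sum]
    refine Finset.sum_congr rfl fun σ _ => ?_
    rw [A.map_smul_univ, smul_eq_mul, mul_comm]
  have h := isPoly_sum (Finset.univ : Finset (Fin k → Fin d)) _ _ fun σ _ =>
    (isPoly_prod_coord_sub hc σ).const_mul (A (fun i => Pi.single (σ i) (1 : ℝ)))
  simp only [← hexp] at h
  refine h.mono ?_
  refine (Finset.sum_le_card_nsmul _ _ (B * 2 ^ k) fun σ _ => ?_).trans (by simp)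
  gcongr
  refine le_trans ?_ hA
  have h2 := A.le_opNorm (fun i => Pi.single (σ i) (1 : ℝ))
  simpa [Pi.norm_single] using h2

theorem isPoly_taylorPoly {F : Pt d → ℝ} {r : ℕ} {B : ℝ} {c : Pt d} (hc : c ∈ cube d)
    (hB : ∀ k ≤ r, ‖iteratedFDerivWithin ℝ k F (cube d) c‖ ≤ B) :
    IsPoly r (∑ k ∈ Finset.range (r + 1), d ^ k * (B * 2 ^ k)) (taylorPoly F r c) := by
  refine isPoly_sum _ _ _ fun k hk => ?_
  have hk' : k ≤ r := by
    have := Finset.mem_range.1 hk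
    omega
  have h := ((isPoly_multilinear hc _ (hB k hk')).const_mul (1 / k.factorial)).degree_mono hk'
  have hB0 : 0 ≤ B := (norm_nonneg _).trans (hB k hk')
  simp only [mul_comm (1 / (k.factorial : ℝ))] at h
  refine h.mono ?_
  refine mul_le_of_le_one_left (by positivity) ?_
  rw [abs_of_nonneg (by positivity)]
  exact div_le_one_of_le₀ (by exact_mod_cast Nat.succ_le_of_lt k.factorial_pos) (by positivity)

end Taylor

/-! ### Polynomials that detect the sign of a smooth function with a margin -/

section SignPolynomials

variable {d : ℕ}

theorem exists_abs_sub_eq_dist (hd : 1 ≤ d) (x c : Pt d) : ∃ j, |x j - c j| = dist x c := by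
  have : Nonempty (Fin d) := ⟨⟨0, hd⟩⟩
  obtain ⟨j, -, hj⟩ := Finset.exists_mem_eq_sup Finset.univ Finset.univ_nonempty
    fun i => nndist (x i) (c i)
  refine ⟨j, ?_⟩
  rw [dist_pi_def, hj, ← Real.dist_eq, coe_nndist]

theorem dist_pow_le_sum (hd : 1 ≤ d) (x c : Pt d) (m : ℕ) :
    dist x c ^ (2 * m) ≤ ∑ j, (x j - c j) ^ (2 * m) := by
  obtain ⟨j, hj⟩ := exists_abs_sub_eq_dist hd x c
  rw [← hj, pow_mul, sq_abs, ← pow_mul]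
  exact Finset.single_le_sum (f := fun j => (x j - c j) ^ (2 * m))
    (fun i _ => (even_two_mul m).pow_nonneg _) (Finset.mem_univ j)

theorem sum_le_dist_pow (x c : Pt d) (m : ℕ) :
    ∑ j, (x j - c j) ^ (2 * m) ≤ d * dist x c ^ (2 * m) := by
  refine (Finset.sum_le_card_nsmul _ _ (dist x c ^ (2 * m)) fun j _ => ?_).trans (by simp)
  rw [pow_mul, ← sq_abs, ← pow_mul, ← Real.dist_eq]
  gcongr
  exact dist_le_pi_dist x c j

/-- The point of the grid of mesh `1 / M` with indices `i`. -/
def gridPt (M : ℕ) (i : Fin d → Fin (M + 1)) : Pt d := fun j => (i j : ℝ) / M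

theorem gridPt_mem {M : ℕ} (hM : 1 ≤ M) (i : Fin d → Fin (M + 1)) : gridPt M i ∈ cube d := by
  have hM' : (0 : ℝ) < M := by exact_mod_cast hM
  refine ⟨fun j => ?_, fun j => ?_⟩
  · exact div_nonneg (Nat.cast_nonneg _) hM'.le
  · refine div_le_one_of_le₀ ?_ hM'.le
    exact Nat.cast_le.2 (Nat.lt_succ_iff.1 (i j).2)

theorem exists_dist_gridPt_le {M : ℕ} (hM : 1 ≤ M) {x : Pt d} (hx : x ∈ cube d) :
    ∃ i, dist x (gridPt M i) ≤ 1 / M := by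
  have hM' : (0 : ℝ) < M := by exact_mod_cast hM
  have hfl : ∀ j, ⌊x j * M⌋₊ < M + 1 := fun j => by
    refine Nat.lt_succ_of_le (Nat.floor_le_of_le ?_)
    have : x j ≤ 1 := hx.2 j
    nlinarith
  refine ⟨fun j => ⟨⌊x j * M⌋₊, hfl j⟩, (dist_pi_le_iff (by positivity)).2 fun j => ?_⟩
  have h0 : 0 ≤ x j * M := mul_nonneg (hx.1 j) hM'.le
  have h1 := Nat.floor_le h0
  have h2 := Nat.lt_floor_add_one (x j * M)
  have e : x j - (⌊x j * M⌋₊ : ℝ) / M = (x j * M - ⌊x j * M⌋₊) / M := by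
    field_simp
  rw [Real.dist_eq, gridPt, e, abs_of_nonneg (div_nonneg (by linarith) hM'.le)]
  gcongr
  linarith

/-- The Taylor polynomial at `c` of `F - 1 / 2`, lowered away from `c`. -/
def loweredTaylor (F : Pt d → ℝ) (r : ℕ) (K : ℝ) (c x : Pt d) : ℝ :=
  taylorPoly F r c x + -(1 / 2) + -K * ∑ j, (x j - c j) ^ (2 * (r + 1))

theorem isPoly_loweredTaylor {F : Pt d → ℝ} {r : ℕ} {B K : ℝ} {c : Pt d} (hc : c ∈ cube d)
    (hB : ∀ k ≤ r, ‖iteratedFDerivWithin ℝ k F (cube d) c‖ ≤ B) (hK : 0 ≤ K) :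
    IsPoly (2 * (r + 1))
      (∑ k ∈ Finset.range (r + 1), d ^ k * (B * 2 ^ k) + 1 / 2 + K * (d * 2 ^ (2 * (r + 1))))
      (loweredTaylor F r K c) := by
  have h1 := (isPoly_taylorPoly hc hB).degree_mono (show r ≤ 2 * (r + 1) by omega)
  have h2 := (isPoly_const (d := d) (-(1 / 2))).degree_mono (Nat.zero_le (2 * (r + 1)))
  have h3 : ∀ j ∈ (Finset.univ : Finset (Fin d)), IsPoly (2 * (r + 1)) (2 ^ (2 * (r + 1)))
      (fun x : Pt d => (x j - c j) ^ (2 * (r + 1))) := fun j _ => by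
    simpa using isPoly_prod_coord_sub hc (fun _ : Fin (2 * (r + 1)) => j)
  have h4 := (h1.add h2).add ((isPoly_sum _ _ _ h3).const_mul (-K))
  refine h4.mono (le_of_eq ?_)
  rw [abs_neg, abs_neg, abs_of_nonneg hK, abs_of_pos (by norm_num)]
  simp

/-- With s = |x - c|^(r+1), the Taylor error is at most Bs and the penalty at least B²s²/(2ζ).
Completing the square bounds their difference by ζ/2, at any distance from c. -/
theorem loweredTaylor_le {F : Pt d → ℝ} {r : ℕ} {B ζ : ℝ} {c x : Pt d} (hd : 1 ≤ d)
    (hζ : 0 < ζ) (hT : |F x - taylorPoly F r c x| ≤ B * dist x c ^ (r + 1))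
    (hF : F x - 1 / 2 ≤ -ζ) : loweredTaylor F r (B ^ 2 / (2 * ζ)) c x ≤ -(ζ / 2) := by
  have h1 := dist_pow_le_sum hd x c (r + 1)
  rw [mul_comm 2, pow_mul] at h1
  set s := dist x c ^ (r + 1)
  have h2 : B * s - B ^ 2 / (2 * ζ) * s ^ 2 ≤ ζ / 2 := by
    have e : ζ / 2 - (B * s - B ^ 2 / (2 * ζ) * s ^ 2) = (B * s - ζ) ^ 2 / (2 * ζ) := by
      field_simp
      ring
    have : 0 ≤ (B * s - ζ) ^ 2 / (2 * ζ) := by positivity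
    linarith
  have h3 : B ^ 2 / (2 * ζ) * s ^ 2
      ≤ B ^ 2 / (2 * ζ) * ∑ j, (x j - c j) ^ (2 * (r + 1)) := by
    rw [mul_comm 2 (r + 1)]
    gcongr
  have h4 := (abs_le.1 hT).1
  unfold loweredTaylor
  linarith

/-- Near c both the Taylor error and the penalty are at most ζ/8, so at least ζ/2 of the margin ζ
survives. -/
theorem le_loweredTaylor {F : Pt d → ℝ} {r : ℕ} {B ζ : ℝ} {c x : Pt d} (hd : 1 ≤ d) (hB : 0 < B)
    (hζ : 0 < ζ) (hT : |F x - taylorPoly F r c x| ≤ B * dist x c ^ (r + 1))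
    (hs : dist x c ^ (r + 1) ≤ ζ / (8 * B * d))
    (hF : ζ ≤ F x - 1 / 2) : ζ / 2 ≤ loweredTaylor F r (B ^ 2 / (2 * ζ)) c x := by
  have h1 := sum_le_dist_pow x c (r + 1)
  rw [mul_comm 2, pow_mul, ← mul_comm 2] at h1
  have h0 : 0 ≤ dist x c ^ (r + 1) := by positivity
  set s := dist x c ^ (r + 1)
  have hd' : (1 : ℝ) ≤ d := by exact_mod_cast hd
  have h2 : B * s ≤ ζ / 8 := by
    refine (mul_le_mul_of_nonneg_left hs hB.le).trans ?_
    have e : B * (ζ / (8 * B * d)) = ζ / 8 / d := by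
      field_simp
    rw [e]
    exact div_le_self (by positivity) hd'
  have h3 : B ^ 2 / (2 * ζ) * ∑ j, (x j - c j) ^ (2 * (r + 1)) ≤ ζ / 8 := by
    have h5 : B ^ 2 / (2 * ζ) * ∑ j, (x j - c j) ^ (2 * (r + 1))
        ≤ B ^ 2 / (2 * ζ) * (d * (ζ / (8 * B * d)) ^ 2) := by
      gcongr
      exact h1.trans (by gcongr)
    refine h5.trans ?_
    have e : B ^ 2 / (2 * ζ) * (d * (ζ / (8 * B * d)) ^ 2) = ζ / 128 / d := by
      field_simp
      norm_num
    rw [e]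
    exact (div_le_self (by positivity) hd').trans (by linarith)
  have h4 := (abs_le.1 hT).2
  unfold loweredTaylor
  linarith

/-- With h = s^(1/α) ≤ 1 and M = ⌈1/h⌉ one has M + 1 ≤ 3/h. -/
theorem exists_mesh {s : ℝ} (hs : 0 < s) (hs1 : s ≤ 1) (d : ℕ) {α : ℕ} (hα : 1 ≤ α) :
    ∃ M : ℕ, 1 ≤ M ∧ (1 / (M : ℝ)) ^ α ≤ s ∧
      ((M : ℝ) + 1) ^ d ≤ 3 ^ d * s ^ (-(d : ℝ) / (α : ℝ)) := by
  have hα' : (α : ℝ) ≠ 0 := by positivity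
  set h := s ^ (1 / (α : ℝ)) with hh
  have hpos : 0 < h := Real.rpow_pos_of_pos hs _
  have hle : h ≤ 1 := Real.rpow_le_one hs.le hs1 (by positivity)
  have hpow : h ^ α = s := by
    rw [hh, ← Real.rpow_natCast, ← Real.rpow_mul hs.le, one_div_mul_cancel hα', Real.rpow_one]
  have h1 : 1 ≤ 1 / h := (one_le_div hpos).2 hle
  have h2 := Nat.le_ceil (1 / h)
  have h3 := Nat.ceil_lt_add_one (zero_le_one.trans h1)
  have hM : (0 : ℝ) < (⌈1 / h⌉₊ : ℝ) := by linarith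
  refine ⟨⌈1 / h⌉₊, by exact_mod_cast hM, ?_, ?_⟩
  · rw [← hpow]
    gcongr
    rw [div_le_iff₀ hM]
    rwa [div_le_iff₀ hpos, mul_comm] at h2
  · have h4 : s ^ (-(d : ℝ) / (α : ℝ)) = (1 / h) ^ d := by
      rw [hh, one_div, ← Real.rpow_neg hs.le, ← Real.rpow_natCast, ← Real.rpow_mul hs.le]
      congr 1
      field_simp
    rw [h4, ← mul_pow]
    gcongr
    linarith

theorem exists_sign_polynomials (d α : ℕ) (hd : 1 ≤ d) (hα : 1 ≤ α) (B : ℝ) :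
    ∃ C : ℝ, 1 ≤ C ∧ ∀ (X : Set (Pt d)) (η : Pt d → ℝ) (ζ : ℝ), X ⊆ cube d →
      InHolderBall α B X η → 0 < ζ → ζ ≤ 1 / 2 → (∀ x ∈ X, ζ < |η x - 1 / 2|) →
      ∃ N : ℕ, (N : ℝ) ≤ C * ζ ^ (-(d : ℝ) / (α : ℝ)) ∧
        ∃ a : Fin N → (Fin (2 * α) → Option (Fin d)) → ℝ,
          (∀ c, ∑ τ, |a c τ| ≤ C / ζ) ∧
          ∀ x ∈ X,
            (1 / 2 ≤ η x → ∃ c, ζ / 2 ≤ ∑ τ, a c τ * ∏ i, coord x (τ i)) ∧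
            (η x < 1 / 2 → ∀ c, ∑ τ, a c τ * ∏ i, coord x (τ i) ≤ -(ζ / 2)) := by
  obtain ⟨r, rfl⟩ : ∃ r, α = r + 1 := ⟨α - 1, by omega⟩
  set B₀ : ℝ := max B 1 with hB₀
  have hB1 : 1 ≤ B₀ := le_max_right _ _
  have hd' : (1 : ℝ) ≤ d := by exact_mod_cast hd
  set κ : ℝ := 1 / (8 * B₀ * d) with hκ
  have hκ0 : 0 < κ := by positivity
  have hκ1 : κ ≤ 1 := by
    rw [hκ, div_le_one (by positivity)]
    nlinarith
  set R₁ : ℝ := ∑ k ∈ Finset.range (r + 1), (d : ℝ) ^ k * (B₀ * 2 ^ k) + 1 / 2 with hR₁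
  have hR₁0 : 0 ≤ R₁ := by positivity
  set R₂ : ℝ := B₀ ^ 2 / 2 * (d * 2 ^ (2 * (r + 1))) with hR₂
  have hR₂0 : 0 ≤ R₂ := by positivity
  set E : ℝ := -(d : ℝ) / ((r + 1 : ℕ) : ℝ) with hE
  have hκE : 0 < κ ^ E := Real.rpow_pos_of_pos hκ0 _
  refine ⟨1 + (R₁ + R₂) + 3 ^ d * κ ^ E, by
    have : 0 ≤ (3 : ℝ) ^ d * κ ^ E := by positivity
    linarith, ?_⟩
  intro X η ζ hX hη hζ hζ2 hmargin
  obtain ⟨F, hF, hFB, hFL, hFη⟩ := hη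
  simp only [Nat.add_sub_cancel] at hF hFB hFL
  have hFB' : ∀ x ∈ cube d, ∀ k ≤ r, ‖iteratedFDerivWithin ℝ k F (cube d) x‖ ≤ B₀ :=
    fun x hx k hk => (hFB k hk x hx).trans (le_max_left _ _)
  have hFL' : ∀ x ∈ cube d, ∀ y ∈ cube d, ‖iteratedFDerivWithin ℝ r F (cube d) x
      - iteratedFDerivWithin ℝ r F (cube d) y‖ ≤ B₀ * dist x y := fun x hx y hy =>
    (hFL x hx y hy).trans (mul_le_mul_of_nonneg_right (le_max_left _ _) dist_nonneg)
  -- The value ζκ = ζ/(8 B₀ d) is exactly the radius condition of `le_loweredTaylor`. Replacing B by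
  -- B₀ ≥ 1 keeps κ in (0, 1].
  obtain ⟨M, hM, hMs, hMN⟩ := exists_mesh (s := ζ * κ) (by positivity) (by nlinarith) d
    (α := r + 1) (by omega)
  have hgrid : ∀ i : Fin d → Fin (M + 1), gridPt M i ∈ cube d := gridPt_mem hM
  choose a ha hap using fun i => isPoly_loweredTaylor (hgrid i) (hFB' _ (hgrid i))
    (show 0 ≤ B₀ ^ 2 / (2 * ζ) by positivity)
  have hT : ∀ i, ∀ x ∈ cube d, |F x - taylorPoly F r (gridPt M i) x|
      ≤ B₀ * dist x (gridPt M i) ^ (r + 1) := fun i x hx =>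
    abs_sub_taylorPoly_le hF (by positivity) hFL' (hgrid i) hx
  refine ⟨(M + 1) ^ d, ?_, fun c => a (finFunctionFinEquiv.symm c), fun c => ?_, fun x hx => ?_⟩
  · push_cast
    refine hMN.trans ?_
    rw [← hE, Real.mul_rpow hζ.le hκ0.le]
    have hζE : 0 < ζ ^ E := Real.rpow_pos_of_pos hζ _
    nlinarith [mul_nonneg (add_nonneg hR₁0 hR₂0) hζE.le]
  · refine (ha _).trans ?_
    rw [le_div_iff₀ hζ, ← hR₁]
    have e : B₀ ^ 2 / (2 * ζ) * (d * 2 ^ (2 * (r + 1))) * ζ = R₂ := by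
      rw [hR₂]
      field_simp
    rw [add_mul, e]
    have : 0 ≤ (3 : ℝ) ^ d * κ ^ E := by positivity
    nlinarith
  · have hm := hmargin x hx
    have hxF := hFη x hx
    constructor
    · intro hηx
      rw [abs_of_nonneg (by linarith)] at hm
      obtain ⟨i, hi⟩ := exists_dist_gridPt_le hM (hX hx)
      refine ⟨finFunctionFinEquiv i, ?_⟩
      simp only [Equiv.symm_apply_apply]
      rw [← hap]
      refine le_loweredTaylor hd (by positivity) hζ (hT i x (hX hx)) ?_ (by rw [hxF]; exact hm.le)
      calc dist x (gridPt M i) ^ (r + 1) ≤ (1 / (M : ℝ)) ^ (r + 1) := by gcongr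
        _ ≤ ζ * κ := hMs
        _ = ζ / (8 * B₀ * d) := by rw [hκ]; ring
    · intro hηx c
      rw [abs_of_neg (by linarith)] at hm
      rw [← hap]
      exact loweredTaylor_le hd hζ (hT _ x (hX hx)) (by rw [hxF]; linarith)

end SignPolynomials

/-! ### Risks -/

section Risk

variable {d : ℕ} {X : Set (Pt d)} {ρ : Measure (Pt d × ℝ)} {η : Pt d → ℝ}

theorem bayes_eq_or (x : Pt d) : bayes η x = 1 ∨ bayes η x = -1 := by
  unfold bayes
  split_ifs <;> simp

theorem ae_mem (h : IsDataDistribution X ρ) :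
    ∀ᵐ z ∂ρ, z.1 ∈ X ∧ (z.2 = -1 ∨ z.2 = 1) := by
  refine measure_mono_null ?_ h.2
  intro z hz hmem
  exact hz hmem

theorem IsCondProbOne.measure_prod_neg_one (hX : MeasurableSet X) (hρ : IsDataDistribution X ρ)
    (hη : IsCondProbOne X ρ η) {S : Set (Pt d)} (hS : MeasurableSet S) :
    ρ (S ×ˢ {-1}) = ∫⁻ x in S, ENNReal.ofReal (1 - η x) ∂(marginal ρ) := by
  have := hρ.1
  obtain ⟨hm, h01, h1⟩ := hη
  have hXae : ∀ᵐ x ∂(marginal ρ), x ∈ X := by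
    exact (ae_map_iff (p := (· ∈ X)) measurable_fst.aemeasurable hX).2
      ((ae_mem hρ).mono fun z hz => hz.1)
  have hsum : marginal ρ S = ρ (S ×ˢ {1}) + ρ (S ×ˢ {-1}) := by
    rw [marginal, Measure.map_apply measurable_fst hS, ← measure_union _
      (hS.prod (measurableSet_singleton _))]
    · refine measure_congr ?_
      filter_upwards [ae_mem hρ] with z hz
      refine propext ?_
      change z.1 ∈ S ↔ (z.1 ∈ S ∧ z.2 = 1) ∨ (z.1 ∈ S ∧ z.2 = -1)
      rcases hz.2 with h | h <;> rw [h] <;> norm_num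
    · rw [Set.disjoint_left]
      rintro z ⟨-, hz⟩ ⟨-, hz'⟩
      rw [Set.mem_singleton_iff] at hz hz'
      linarith
  have hint : marginal ρ S = ∫⁻ x in S, ENNReal.ofReal (η x) ∂(marginal ρ)
      + ∫⁻ x in S, ENNReal.ofReal (1 - η x) ∂(marginal ρ) := by
    rw [← lintegral_add_left hm.ennreal_ofReal, ← setLIntegral_one]
    refine lintegral_congr_ae ?_
    filter_upwards [ae_restrict_of_ae hXae] with x hx
    rw [← ENNReal.ofReal_add (h01 x hx).1 (by linarith [(h01 x hx).2])]
    simp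
  rw [hsum, h1 S hS] at hint
  refine (ENNReal.add_right_inj ?_).1 hint
  rw [← h1 S hS]
  exact measure_ne_top _ _

theorem measure_misclassified (hX : MeasurableSet X) (hρ : IsDataDistribution X ρ)
    (hη : IsCondProbOne X ρ η) {h : Pt d → ℝ} (hm : Measurable h)
    (h1 : ∀ x, h x = 1 ∨ h x = -1) :
    ρ {z | z.2 * h z.1 = -1} = ∫⁻ x,
      (if h x = 1 then ENNReal.ofReal (1 - η x) else ENNReal.ofReal (η x)) ∂(marginal ρ) := by
  have hH : MeasurableSet {x | h x = 1} := hm (measurableSet_singleton 1)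
  have hsplit : ρ {z | z.2 * h z.1 = -1}
      = ρ ({x | h x = 1} ×ˢ {-1}) + ρ ({x | h x = 1}ᶜ ×ˢ {1}) := by
    rw [← measure_union _ (hH.compl.prod (measurableSet_singleton _))]
    · refine measure_congr ?_
      filter_upwards [ae_mem hρ] with z hz
      refine propext ?_
      change z.2 * h z.1 = -1 ↔ (h z.1 = 1 ∧ z.2 = -1) ∨ (¬ h z.1 = 1 ∧ z.2 = 1)
      rcases hz.2 with h2 | h2 <;> rcases h1 z.1 with h3 | h3 <;> rw [h2, h3] <;> norm_num
    · rw [Set.disjoint_left]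
      rintro z ⟨hz, -⟩ ⟨hz', -⟩
      exact hz' hz
  rw [hsplit, hη.measure_prod_neg_one hX hρ hH, hη.2.2 _ hH.compl,
    ← lintegral_add_compl (fun x =>
      if h x = 1 then ENNReal.ofReal (1 - η x) else ENNReal.ofReal (η x)) hH]
  congr 1
  · exact setLIntegral_congr_fun hH fun x hx => (if_pos (show h x = 1 from hx)).symm
  · exact setLIntegral_congr_fun hH.compl fun x hx =>
      (if_neg (show ¬ h x = 1 from hx)).symm

theorem measurable_bayes (hη : Measurable η) : Measurable (bayes η) :=
  Measurable.ite (measurableSet_le (measurable_const.sub hη) hη) measurable_const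
    measurable_const

/-- The risk integrates η or 1 - η according to the predicted label, and the Bayes rule picks the
smaller one at each point. -/
theorem misclass_bayes_le (hX : MeasurableSet X) (hρ : IsDataDistribution X ρ)
    (hη : IsCondProbOne X ρ η) {h : Pt d → ℝ} (hm : Measurable h)
    (h1 : ∀ x, h x = 1 ∨ h x = -1) : misclass ρ (bayes η) ≤ misclass ρ h := by
  have := hρ.1
  refine ENNReal.toReal_mono (measure_ne_top _ _) ?_
  rw [measure_misclassified hX hρ hη hm h1,
    measure_misclassified hX hρ hη (measurable_bayes hη.1) bayes_eq_or]
  refine lintegral_mono fun x => ?_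
  by_cases hb : 1 - η x ≤ η x
  · have h2 : bayes η x = 1 := if_pos hb
    rw [if_pos h2]
    split_ifs
    · exact le_rfl
    · exact ENNReal.ofReal_le_ofReal hb
  · have h2 : bayes η x = -1 := if_neg hb
    rw [if_neg (by rw [h2]; norm_num)]
    split_ifs
    · exact ENNReal.ofReal_le_ofReal (not_le.1 hb).le
    · exact le_rfl

theorem misclass_le_advMisclass (hρ : IsDataDistribution X ρ) {δ : ℝ} (hδ : 0 ≤ δ)
    (h : Pt d → ℝ) : misclass ρ h ≤ advMisclass ρ X δ h := by
  have := hρ.1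
  refine ENNReal.toReal_mono (measure_ne_top _ _) (measure_mono_ae ?_)
  filter_upwards [ae_mem hρ] with z hz hz'
  exact ⟨z.1, hz.1, by simpa using hδ, hz'⟩

theorem misclass_bayes_le_bestAdvMisclass (hX : MeasurableSet X) (hρ : IsDataDistribution X ρ)
    (hη : IsCondProbOne X ρ η) {δ : ℝ} (hδ : 0 ≤ δ) :
    misclass ρ (bayes η) ≤ bestAdvMisclass ρ X δ := by
  refine le_csInf ⟨_, fun _ => 1, measurable_const, fun _ => Or.inl rfl, rfl⟩ ?_
  rintro _ ⟨h, hm, h1, rfl⟩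
  exact (misclass_bayes_le hX hρ hη hm h1).trans (misclass_le_advMisclass hρ hδ h)

/-- The infimum is attained for each fixed f: divide by the integral when it is non-zero. If it is
zero, one admissible constant already forces the left side to vanish. -/
theorem lintegral_le_normJ_mul {f : Pt d → ℝ} (hf : Measurable f) (hJ : normJ X ρ < ⊤)
    (hfin : ∫⁻ x, ‖f x‖ₑ ∂(volume.restrict X) ≠ ⊤) :
    ∫⁻ x, ‖f x‖ₑ ∂(marginal ρ) ≤ normJ X ρ * ∫⁻ x, ‖f x‖ₑ ∂(volume.restrict X) := by
  obtain ⟨K₀, hK₀, -⟩ := sInf_lt_iff.1 hJ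
  rcases eq_or_ne (∫⁻ x, ‖f x‖ₑ ∂(volume.restrict X)) 0 with h0 | h0
  · have h1 := hK₀ f hf
    rw [h0, mul_zero] at h1 ⊢
    exact h1
  · rw [← ENNReal.div_le_iff h0 hfin]
    refine le_sInf fun K hK => ?_
    rw [ENNReal.div_le_iff h0 hfin]
    exact hK f hf

theorem marginal_le_normJ_mul {S : Set (Pt d)} (hS : MeasurableSet S) (hJ : normJ X ρ < ⊤)
    (hfin : volume S ≠ ⊤) : marginal ρ S ≤ normJ X ρ * volume S := by
  have e : ∀ μ : Measure (Pt d), ∫⁻ x, ‖S.indicator (fun _ => (1 : ℝ)) x‖ₑ ∂μ = μ S := by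
    intro μ
    rw [← lintegral_indicator_one hS]
    refine lintegral_congr fun x => ?_
    by_cases hx : x ∈ S <;> simp [hx]
  have hle : volume.restrict X S ≤ volume S := Measure.restrict_apply_le X S
  have h := lintegral_le_normJ_mul (X := X) (ρ := ρ) (f := S.indicator (fun _ => (1 : ℝ)))
    (measurable_const.indicator hS) hJ (by rw [e]; exact ne_top_of_le_ne_top hfin hle)
  rw [e, e] at h
  exact h.trans (by gcongr)

theorem measure_near_sample_le {n : ℕ} (D : Sample d n) (hJ : normJ X ρ < ⊤) {r : ℝ}
    (hr : 0 ≤ r) :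
    ρ {z | ∃ i, dist z.1 (D i).1 ≤ r} ≤ ENNReal.ofReal ((normJ X ρ).toReal * (2 * r) ^ d * n) := by
  have hset : {z : Pt d × ℝ | ∃ i, dist z.1 (D i).1 ≤ r}
      = Prod.fst ⁻¹' ⋃ i, Metric.closedBall (D i).1 r := by
    ext z
    simp
  have hball : ∀ i, volume (Metric.closedBall (D i).1 r) = ENNReal.ofReal ((2 * r) ^ d) :=
    fun i => by simpa using Real.volume_pi_closedBall (D i).1 hr
  have hmeas : MeasurableSet (⋃ i, Metric.closedBall (D i).1 r) :=
    MeasurableSet.iUnion fun i => measurableSet_closedBall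
  rw [hset, ← Measure.map_apply measurable_fst hmeas]
  refine (measure_iUnion_fintype_le _ _).trans ?_
  refine (Finset.sum_le_card_nsmul _ _ (normJ X ρ * ENNReal.ofReal ((2 * r) ^ d))
    fun i _ => ?_).trans (le_of_eq ?_)
  · rw [← hball i]
    exact marginal_le_normJ_mul measurableSet_closedBall hJ (by
      rw [hball]
      exact ENNReal.ofReal_ne_top)
  · rw [ENNReal.ofReal_mul (by positivity), ENNReal.ofReal_mul ENNReal.toReal_nonneg,
      ENNReal.ofReal_toReal hJ.ne, ENNReal.ofReal_natCast]
    simp [mul_comm]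

/-- Classifiers agreeing with the Bayes rule away from the sample have small excess risk. -/
theorem misclass_sub_le {n : ℕ} (D : Sample d n) (hρ : IsDataDistribution X ρ)
    (hJ : normJ X ρ < ⊤) {r : ℝ} (hr : 0 ≤ r) (h : Pt d → ℝ)
    (hh : ∀ x ∈ X, (∀ i, r < dist x (D i).1) → h x = bayes η x) :
    misclass ρ h - misclass ρ (bayes η) ≤ (normJ X ρ).toReal * (2 * r) ^ d * n := by
  have := hρ.1
  have hle : ρ {z | z.2 * h z.1 = -1}
      ≤ ρ {z | z.2 * bayes η z.1 = -1} + ρ {z | ∃ i, dist z.1 (D i).1 ≤ r} := by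
    refine (measure_mono_ae ?_).trans (measure_union_le _ _)
    filter_upwards [ae_mem hρ] with z hz hz'
    by_cases hc : ∃ i, dist z.1 (D i).1 ≤ r
    · exact Or.inr hc
    · push Not at hc
      left
      change z.2 * bayes η z.1 = -1
      rw [← hh z.1 hz.1 hc]
      exact hz'
  have h2 := ENNReal.toReal_mono (by finiteness) hle
  rw [ENNReal.toReal_add (measure_ne_top _ _) (measure_ne_top _ _)] at h2
  have h3 := ENNReal.toReal_le_of_le_ofReal (by positivity)
    (measure_near_sample_le (X := X) (ρ := ρ) D hJ hr)
  unfold misclass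
  linarith

theorem bayes_eq_of_dist_lt {δ : ℝ} (hsep : WellSeparated X η δ) {x y : Pt d} (hx : x ∈ X)
    (hy : y ∈ X) (hxy : dist x y < 2 * δ) : bayes η x = bayes η y := by
  rcases bayes_eq_or (η := η) x with h1 | h1 <;> rcases bayes_eq_or (η := η) y with h2 | h2
  · rw [h1, h2]
  · exact absurd (hsep x hx y hy h1 h2) (not_le.2 hxy)
  · exact absurd (hsep y hy x hx h2 h1) (not_le.2 (dist_comm x y ▸ hxy))
  · rw [h1, h2]

/-- If x is farther than r + δ from the sample, every perturbation x' in `X` is farther than r.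
There h(x') is the Bayes label of x', which by separation is that of x, so an adversarial error at x
is already a Bayes error. -/
theorem advMisclass_sub_le {n : ℕ} (D : Sample d n) (hX : MeasurableSet X)
    (hρ : IsDataDistribution X ρ) (hη : IsCondProbOne X ρ η) (hJ : normJ X ρ < ⊤) {δ r : ℝ}
    (hδ : 0 < δ) (hsep : WellSeparated X η δ) (hr : 0 ≤ r) (h : Pt d → ℝ)
    (hh : ∀ x ∈ X, (∀ i, r < dist x (D i).1) → h x = bayes η x) :
    advMisclass ρ X δ h - bestAdvMisclass ρ X δ
      ≤ (normJ X ρ).toReal * (2 * (r + δ)) ^ d * n := by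
  have := hρ.1
  have hle : ρ {z | ∃ x' ∈ X, dist x' z.1 ≤ δ ∧ z.2 * h x' = -1}
      ≤ ρ {z | z.2 * bayes η z.1 = -1} + ρ {z | ∃ i, dist z.1 (D i).1 ≤ r + δ} := by
    refine (measure_mono_ae ?_).trans (measure_union_le _ _)
    filter_upwards [ae_mem hρ] with z hz hz'
    by_cases hc : ∃ i, dist z.1 (D i).1 ≤ r + δ
    · exact Or.inr hc
    · push Not at hc
      obtain ⟨x', hx', hd, hxz⟩ := hz'
      left
      change z.2 * bayes η z.1 = -1
      rw [hh x' hx' fun i => by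
          have h1 := hc i
          have h2 := dist_triangle_left z.1 (D i).1 x'
          linarith,
        bayes_eq_of_dist_lt hsep hx' hz.1 (by linarith)] at hxz
      exact hxz
  have h2 := ENNReal.toReal_mono (by finiteness) hle
  rw [ENNReal.toReal_add (measure_ne_top _ _) (measure_ne_top _ _)] at h2
  have h3 := ENNReal.toReal_le_of_le_ofReal (by positivity)
    (measure_near_sample_le (X := X) (ρ := ρ) D hJ (show 0 ≤ r + δ by linarith))
  have h4 := misclass_bayes_le_bestAdvMisclass hX hρ hη hδ.le
  unfold misclass at h4
  unfold advMisclass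
  linarith

theorem measurableSet_separatedSamples (n : ℕ) (hX : MeasurableSet X) (δ : ℝ) :
    MeasurableSet (separatedSamples d n X δ) := by
  have h1 : MeasurableSet {D : Sample d n | ∀ i, D i ∈ X ×ˢ ({-1, 1} : Set ℝ)} := by
    have hp : MeasurableSet (X ×ˢ ({-1, 1} : Set ℝ)) := hX.prod (Set.toFinite _).measurableSet
    simp only [Set.ofPred_forall]
    exact MeasurableSet.iInter fun i => (measurable_pi_apply i) hp
  have h2 : Measurable (separation : Sample d n → ℝ≥0∞) := by
    unfold separation
    refine Measurable.div_const ?_ 2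
    refine Measurable.iInf fun i => Measurable.iInf fun j => Measurable.iInf fun _ => ?_
    exact (measurable_pi_apply i).fst.edist (measurable_pi_apply j).fst
  exact h1.inter (measurableSet_lt measurable_const (h2.div_const 3))

/-- The conditional measure has mass at most 1, also when the conditioning event is null, and the
upper integral asks for no measurability of `g`. -/
theorem expectSep_le (n : ℕ) (hX : MeasurableSet X) (δ : ℝ) (g : Sample d n → ℝ) (b : ℝ)
    (hg : ∀ D ∈ separatedSamples d n X δ, g D ≤ b) :
    expectSep n ρ X δ g ≤ ENNReal.ofReal b := by
  have hms := measurableSet_separatedSamples (d := d) n hX δ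
  unfold expectSep
  set μ := Measure.pi fun _ : Fin n => ρ
  have hae : ∀ᵐ D ∂(μ[|separatedSamples d n X δ]), ENNReal.ofReal (g D) ≤ ENNReal.ofReal b := by
    refine (Measure.ae_smul_measure (ae_restrict_mem hms) _).mono fun D hD => ?_
    exact ENNReal.ofReal_le_ofReal (hg D hD)
  refine (lintegral_mono_ae hae).trans ?_
  rw [lintegral_const]
  refine mul_le_of_le_one_right zero_le ?_
  rw [ProbabilityTheory.cond, Measure.smul_apply, Measure.restrict_apply_univ, smul_eq_mul]
  exact ENNReal.inv_mul_le_one _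

theorem lt_dist_of_mem_separatedSamples {n : ℕ} {δ : ℝ} {D : Sample d n} (hδ : 0 ≤ δ)
    (hD : D ∈ separatedSamples d n X δ) {i j : Fin n} (hij : i ≠ j) :
    6 * δ < dist (D i).1 (D j).1 := by
  have h1 : separation D / 3 ≤ edist (D i).1 (D j).1 / 2 / 3 := by
    unfold separation
    gcongr
    exact iInf_le_of_le i (iInf_le_of_le j (iInf_le _ hij))
  have h2 := hD.2.trans_le h1
  rw [edist_dist] at h2
  have e : ENNReal.ofReal (dist (D i).1 (D j).1) / 2 / 3
      = ENNReal.ofReal (dist (D i).1 (D j).1 / 2 / 3) := by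
    rw [ENNReal.ofReal_div_of_pos (by norm_num), ENNReal.ofReal_div_of_pos (by norm_num)]
    norm_num
  rw [e, ENNReal.ofReal_lt_ofReal_iff_of_nonneg hδ] at h2
  linarith

end Risk

/-! ### Margins and the empirical adversarial risk -/

section EmpiricalRisk

variable {d n : ℕ} {δ : ℝ} {D : Sample d n} {f : Pt d → ℝ}

/-- Margin 1 on all balls makes the hinge risk zero, which is its least possible value. -/
theorem mem_advMinimizers_hinge {𝓕 : Set (Pt d → ℝ)} (hf𝓕 : f ∈ 𝓕)
    (hf : ∀ i, ∀ x ∈ Metric.closedBall (D i).1 δ, 1 ≤ (D i).2 * f x) :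
    f ∈ advMinimizers hinge δ D 𝓕 := by
  refine ⟨hf𝓕, fun h _ => ?_⟩
  have h0 : advEmpRisk hinge δ D f ≤ 0 := by
    refine mul_nonpos_of_nonneg_of_nonpos (by positivity) (Finset.sum_nonpos fun i _ => ?_)
    refine Real.iSup_le (fun x => ?_) le_rfl
    have := hf i x x.2
    exact (max_eq_right (by linarith)).le
  refine h0.trans (mul_nonneg (by positivity) (Finset.sum_nonneg fun i _ => ?_))
  exact Real.iSup_nonneg fun x => le_max_right _ _

theorem advEmpRisk_logistic_le {β : ℝ} (hβ : 0 < β)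
    (hf : ∀ i, ∀ x ∈ Metric.closedBall (D i).1 δ, Real.log (1 / β) ≤ (D i).2 * f x) :
    advEmpRisk logistic δ D f ≤ β := by
  have h1 : ∀ i, (⨆ x' : Metric.closedBall (D i).1 δ, logistic ((D i).2 * f x')) ≤ β := by
    refine fun i => Real.iSup_le (fun x => ?_) hβ.le
    have h2 := hf i x x.2
    have h3 : Real.exp (-((D i).2 * f x)) ≤ β := by
      rw [← Real.exp_log hβ]
      refine Real.exp_le_exp.2 ?_
      rw [one_div, Real.log_inv] at h2
      linarith
    have h4 := Real.log_le_sub_one_of_pos (x := 1 + Real.exp (-((D i).2 * f x))) (by positivity)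
    unfold logistic
    linarith
  unfold advEmpRisk
  calc 1 / (n : ℝ) * ∑ i, (⨆ x' : Metric.closedBall (D i).1 δ, logistic ((D i).2 * f x'))
      ≤ 1 / (n : ℝ) * ∑ _i : Fin n, β := by
        gcongr with i
        exact h1 i
    _ ≤ β := by
        rw [Finset.sum_const, Finset.card_univ, Fintype.card_fin, nsmul_eq_mul, ← mul_assoc,
          one_div]
        exact mul_le_of_le_one_left hβ.le inv_mul_le_one

end EmpiricalRisk

/-! ### Interpolation at the sample -/

section Bumps

variable {d n : ℕ}

/-- A function equal to `1` on the ball of radius `δ` around `p` and to `0` off the ball of radius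
`δ + r`. -/
def bump (δ r : ℝ) (p x : Pt d) : ℝ :=
  max (1 - (1 / r) * ∑ j, (max (x j - p j - δ) 0 + max (p j - x j - δ) 0)) 0

theorem bump_nonneg (δ r : ℝ) (p x : Pt d) : 0 ≤ bump δ r p x := le_max_right _ _

theorem bump_eq_one {δ r : ℝ} {p x : Pt d} (h : dist x p ≤ δ) : bump δ r p x = 1 := by
  have h0 : ∑ j, (max (x j - p j - δ) 0 + max (p j - x j - δ) 0) = 0 := by
    refine Finset.sum_eq_zero fun j _ => ?_
    have h1 := abs_le.1 ((Real.dist_eq (x j) (p j) ▸ dist_le_pi_dist x p j).trans h)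
    rw [max_eq_right (by linarith), max_eq_right (by linarith), add_zero]
  rw [bump, h0]
  norm_num

theorem bump_eq_zero (hd : 1 ≤ d) {δ r : ℝ} (hr : 0 < r) {p x : Pt d} (h : δ + r ≤ dist x p) :
    bump δ r p x = 0 := by
  obtain ⟨j, hj⟩ := exists_abs_sub_eq_dist hd x p
  refine max_eq_right ?_
  have h1 : r ≤ max (x j - p j - δ) 0 + max (p j - x j - δ) 0 := by
    have e1 := le_max_left (x j - p j - δ) 0
    have e2 := le_max_left (p j - x j - δ) 0
    have e3 := le_max_right (x j - p j - δ) 0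
    have e4 := le_max_right (p j - x j - δ) 0
    rcases abs_cases (x j - p j) with ⟨h2, -⟩ | ⟨h2, -⟩ <;> linarith
  have h2 : r ≤ ∑ j, (max (x j - p j - δ) 0 + max (p j - x j - δ) 0) :=
    h1.trans (Finset.single_le_sum (f := fun j => max (x j - p j - δ) 0 + max (p j - x j - δ) 0)
      (fun i _ => add_nonneg (le_max_right _ _) (le_max_right _ _)) (Finset.mem_univ j))
  have h3 : 1 ≤ (1 / r) * ∑ j, (max (x j - p j - δ) 0 + max (p j - x j - δ) 0) := by
    rw [one_div, ← div_eq_inv_mul, one_le_div hr]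
    exact h2
  linarith

/-- The sum of the bumps at the sample points, weighted by the positive parts of `s * yᵢ`. -/
def bumpSum (s δ r : ℝ) (D : Sample d n) (x : Pt d) : ℝ :=
  ∑ i, max (s * (D i).2) 0 * bump δ r (D i).1 x

theorem bumpSum_nonneg (s δ r : ℝ) (D : Sample d n) (x : Pt d) : 0 ≤ bumpSum s δ r D x :=
  Finset.sum_nonneg fun _ _ => mul_nonneg (le_max_right _ _) (bump_nonneg _ _ _ _)

theorem bumpSum_eq_zero (hd : 1 ≤ d) (s : ℝ) {δ r : ℝ} (hr : 0 < r) {D : Sample d n} {x : Pt d}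
    (h : ∀ i, δ + r ≤ dist x (D i).1) : bumpSum s δ r D x = 0 :=
  Finset.sum_eq_zero fun i _ => by rw [bump_eq_zero hd hr (h i), mul_zero]

theorem bumpSum_eq (hd : 1 ≤ d) (s : ℝ) {δ r : ℝ} (hr : 0 < r) {D : Sample d n} {x : Pt d}
    {i : Fin n} (hi : dist x (D i).1 ≤ δ) (h : ∀ j ≠ i, δ + r ≤ dist x (D j).1) :
    bumpSum s δ r D x = max (s * (D i).2) 0 := by
  unfold bumpSum
  rw [Finset.sum_eq_single i, bump_eq_one hi, mul_one]
  · intro j _ hj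
    rw [bump_eq_zero hd hr (h j hj), mul_zero]
  · simp

theorem measurable_bumpSum (s δ r : ℝ) :
    Measurable fun p : Sample d n × Pt d => bumpSum s δ r p.1 p.2 := by
  unfold bumpSum bump
  fun_prop

/-- The three first layers of the network: clipped coordinates and weighted sums of bumps. -/
theorem isReadable_bumpSum {w : ℕ → ℕ} {U : ℕ} (hd : 1 ≤ d) (hU : d + 2 ≤ U)
    (hw1 : 2 * d + n * (2 * d) ≤ w 1) (hw2 : d + n ≤ w 2) (hw3 : d + 2 ≤ w 3) (δ r : ℝ)
    (D : Sample d n) :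
    IsReadable w U 3
      ((2 * d + n * (2 * d)) * (d + 1) + (d + n) * (2 * d + 1) + (d + 2) * (d + n + 1))
      (Sum.elim (fun (j : Fin d) x => clip (x j))
        (fun (b : Bool) => bumpSum (if b then 1 else -1) δ r D)) := by
  classical
  let F₀ : Fin d → Pt d → ℝ := fun j x => x j
  let G₁ : (Fin d × Bool) ⊕ (Fin n × Fin d × Bool) → Pt d → ℝ := Sum.elim
    (fun p x => x p.1 - if p.2 then 1 else 0)
    (fun p x => if p.2.2 then x p.2.1 - (D p.1).1 p.2.1 - δ else (D p.1).1 p.2.1 - x p.2.1 - δ)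
  have c1 : Fintype.card ((Fin d × Bool) ⊕ (Fin n × Fin d × Bool)) = 2 * d + n * (2 * d) := by
    simp only [Fintype.card_sum, Fintype.card_prod, Fintype.card_fin, Fintype.card_bool]
    ring
  have h1 := (isHidden_zero (d := d) (w := w)).relu (U := d) (c1.trans_le hw1) G₁ (by
    have hc : ∀ j : Fin d, (fun x : Pt d => x j) ∈ readout F₀ := mem_readout_self F₀
    rintro (⟨j, b⟩ | ⟨i, j, b⟩)
    · exact Submodule.sub_mem _ (hc j) (const_mem_readout _ _)
    · cases b
      · exact Submodule.sub_mem _ (Submodule.sub_mem _ (const_mem_readout _ _) (hc j))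
          (const_mem_readout _ _)
      · exact Submodule.sub_mem _ (Submodule.sub_mem _ (hc j) (const_mem_readout _ _))
          (const_mem_readout _ _)) (by simp)
  rw [c1] at h1
  set F₁ := fun k x => max (G₁ k x) 0 with hF₁
  let G₂ : Fin d ⊕ Fin n → Pt d → ℝ := Sum.elim (fun j x => clip (x j))
    (fun i x => 1 - (1 / r) * ∑ j, (max (x j - (D i).1 j - δ) 0 + max ((D i).1 j - x j - δ) 0))
  let S : Fin d ⊕ Fin n → Finset ((Fin d × Bool) ⊕ (Fin n × Fin d × Bool)) := Sum.elim
    (fun j => Finset.univ.image fun b => Sum.inl (j, b))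
    (fun i => Finset.univ.image fun q : Fin d × Bool => Sum.inr (i, q))
  have c2 : Fintype.card (Fin d ⊕ Fin n) = d + n := by simp
  -- Sparsity is essential here: a fully connected second layer would have of order n² weights.
  have h2 := h1.relu_sparse (c2.trans_le hw2) G₂ S (by
    rintro (j | i)
    · have hb : ∀ b, (fun x => F₁ (Sum.inl (j, b)) x)
          ∈ readout (fun i : S (Sum.inl j) => F₁ i) := fun b =>
        mem_readout_self (fun i : S (Sum.inl j) => F₁ i)
          ⟨Sum.inl (j, b), Finset.mem_image_of_mem _ (Finset.mem_univ b)⟩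
      have := Submodule.sub_mem _ (hb false) (hb true)
      convert this using 1
      funext x
      simp [G₂, hF₁, G₁, clip]
    · have hb : ∀ q, (fun x => F₁ (Sum.inr (i, q)) x)
          ∈ readout (fun k : S (Sum.inr i) => F₁ k) := fun q =>
        mem_readout_self (fun k : S (Sum.inr i) => F₁ k)
          ⟨Sum.inr (i, q), Finset.mem_image_of_mem _ (Finset.mem_univ q)⟩
      have := Submodule.sub_mem _ (const_mem_readout _ 1) (Submodule.smul_mem _ (1 / r)
        (Submodule.sum_mem _ fun (j : Fin d) (_ : j ∈ Finset.univ) =>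
          Submodule.add_mem _ (hb (j, true)) (hb (j, false))))
      convert this using 1
      funext x
      simp [G₂, hF₁, G₁, Finset.sum_apply]) (2 * d) (by
    rintro (j | i)
    · refine Finset.card_image_le.trans ?_
      simp only [Finset.card_univ, Fintype.card_bool]
      omega
    · refine Finset.card_image_le.trans (le_of_eq ?_)
      simp only [Finset.card_univ, Fintype.card_prod, Fintype.card_fin, Fintype.card_bool]
      ring)
  rw [c2] at h2
  set F₂ := fun k x => max (G₂ k x) 0 with hF₂
  let G₃ : Fin d ⊕ Bool → Pt d → ℝ := Sum.elim (fun (j : Fin d) x => clip (x j))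
    (fun (b : Bool) => bumpSum (if b then 1 else -1) δ r D)
  have c3 : Fintype.card (Fin d ⊕ Bool) = d + 2 := by simp
  have h3 := h2.relu (U := d + n) (c3.trans_le hw3) G₃ (by
    rintro (j | b)
    · have : G₃ (Sum.inl j) = F₂ (Sum.inl j) := by
        funext x
        simp [G₃, hF₂, G₂, (clip_mem (x j)).1]
      rw [this]
      exact mem_readout_self F₂ _
    · have : G₃ (Sum.inr b)
          = ∑ i, max ((if b then 1 else -1) * (D i).2) 0 • F₂ (Sum.inr i) := by
        funext x
        simp [G₃, bumpSum, bump, hF₂, G₂, Finset.sum_apply]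
      rw [this]
      exact Submodule.sum_mem _ fun i _ =>
        Submodule.smul_mem _ _ (mem_readout_self F₂ (Sum.inr i))) c2.le
  rw [c3] at h3
  have e : (fun k x => max (G₃ k x) 0) = G₃ := by
    funext k x
    refine max_eq_left ?_
    rcases k with j | b
    · exact (clip_mem _).1
    · exact bumpSum_nonneg _ _ _ _ _
  rw [e, Nat.zero_add ((2 * d + n * (2 * d)) * (d + 1))] at h3
  exact h3.isReadable (c3.trans_le hU)

end Bumps

/-! ### The estimators -/

section Estimators

variable {d n N : ℕ}

/-- A network output whose sign is positive where one of the approximated polynomials is. -/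
def signNet (m D' : ℕ) (a : Fin N → (Fin D' → Option (Fin d)) → ℝ) (ζ : ℝ) (x : Pt d) : ℝ :=
  ∑ c, max (∑ τ, a c τ * monoApprox m D' τ x) 0 - ζ / 8

theorem measurable_signNet (m D' : ℕ) (a : Fin N → (Fin D' → Option (Fin d)) → ℝ) (ζ : ℝ) :
    Measurable (signNet m D' a ζ) := by
  have := measurable_monoApprox (d := d) m D'
  unfold signNet
  fun_prop

/-- Clipping makes this bound hold on all of ℝ^d. That is needed because the adversarial balls may
leave the cube. -/
theorem abs_signNet_le {m D' : ℕ} {a : Fin N → (Fin D' → Option (Fin d)) → ℝ} {ζ R : ℝ}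
    (hζ : 0 ≤ ζ) (ha : ∀ c, ∑ τ, |a c τ| ≤ R) (x : Pt d) :
    |signNet m D' a ζ x| ≤ N * R + ζ / 8 := by
  have h1 : ∀ c, max (∑ τ, a c τ * monoApprox m D' τ x) 0 ≤ R := by
    intro c
    refine max_le (le_trans (Finset.sum_le_sum fun τ _ => ?_) (ha c))
      (le_trans (Finset.sum_nonneg fun _ _ => abs_nonneg _) (ha c))
    have h2 := monoApprox_mem m D' τ x
    refine (le_abs_self _).trans ?_
    rw [abs_mul, abs_of_nonneg h2.1]
    exact mul_le_of_le_one_right (abs_nonneg _) h2.2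
  have h3 : ∑ c, max (∑ τ, a c τ * monoApprox m D' τ x) 0 ≤ N * R :=
    (Finset.sum_le_card_nsmul _ _ R fun c _ => h1 c).trans (by simp)
  have h4 : 0 ≤ ∑ c, max (∑ τ, a c τ * monoApprox m D' τ x) 0 :=
    Finset.sum_nonneg fun _ _ => le_max_right _ _
  unfold signNet
  rw [abs_le]
  constructor <;> linarith

theorem sum_monoApprox_near {m D' : ℕ} {a : (Fin D' → Option (Fin d)) → ℝ} {R ε : ℝ}
    (ha : ∑ τ, |a τ| ≤ R) (hε : R * (D' * (1 / 4 ^ m)) ≤ ε) {x : Pt d} (hx : x ∈ cube d) :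
    |∑ τ, a τ * monoApprox m D' τ x - ∑ τ, a τ * ∏ i, coord x (τ i)| ≤ ε := by
  rw [← Finset.sum_sub_distrib]
  refine (Finset.abs_sum_le_sum_abs _ _).trans (le_trans ?_ hε)
  calc ∑ τ, |a τ * monoApprox m D' τ x - a τ * ∏ i, coord x (τ i)|
      ≤ ∑ τ, |a τ| * (D' * (1 / 4 ^ m)) := by
        refine Finset.sum_le_sum fun τ _ => ?_
        rw [← mul_sub, abs_mul]
        exact mul_le_mul_of_nonneg_left (abs_monoApprox_sub_le m D' τ hx) (abs_nonneg _)
    _ = (∑ τ, |a τ|) * (D' * (1 / 4 ^ m)) := by rw [Finset.sum_mul]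
    _ ≤ R * (D' * (1 / 4 ^ m)) := by gcongr

/-- After an error of at most ζ/4, on the negative class every positive part is 0 and the output is
-ζ/8. On the positive class some term is at least ζ/4, and the others cannot cancel it. -/
theorem sgn_mul_signNet {m D' : ℕ} {a : Fin N → (Fin D' → Option (Fin d)) → ℝ} {η : Pt d → ℝ}
    {ζ R s : ℝ} (hζ : 0 < ζ) (hs : 0 < s) (ha : ∀ c, ∑ τ, |a c τ| ≤ R)
    (hε : R * (D' * (1 / 4 ^ m)) ≤ ζ / 4) {x : Pt d} (hx : x ∈ cube d)
    (hpos : 1 / 2 ≤ η x → ∃ c, ζ / 2 ≤ ∑ τ, a c τ * ∏ i, coord x (τ i))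
    (hneg : η x < 1 / 2 → ∀ c, ∑ τ, a c τ * ∏ i, coord x (τ i) ≤ -(ζ / 2)) :
    sgn (s * signNet m D' a ζ x) = bayes η x := by
  have hnear := fun c => abs_le.1 (sum_monoApprox_near (ha c) hε hx)
  rcases le_or_gt (1 / 2) (η x) with h | h
  · obtain ⟨c, hc⟩ := hpos h
    have h1 : ζ / 4 ≤ max (∑ τ, a c τ * monoApprox m D' τ x) 0 :=
      le_max_of_le_left (by linarith [(hnear c).1])
    have h2 := h1.trans (Finset.single_le_sum
      (f := fun c => max (∑ τ, a c τ * monoApprox m D' τ x) 0)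
      (fun _ _ => le_max_right _ _) (Finset.mem_univ c))
    have h3 : 0 ≤ signNet m D' a ζ x := by
      unfold signNet
      linarith
    rw [sgn, bayes, if_pos (mul_nonneg hs.le h3), if_pos (by linarith)]
  · have h1 : ∑ c, max (∑ τ, a c τ * monoApprox m D' τ x) 0 = 0 :=
      Finset.sum_eq_zero fun c _ => max_eq_right (by linarith [(hnear c).2, hneg h c])
    have h3 : signNet m D' a ζ x < 0 := by
      unfold signNet
      linarith
    rw [sgn, bayes, if_neg (not_le.2 (mul_neg_of_pos_of_neg hs h3)), if_neg (by linarith)]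

/-- A classifier `T` overruled near the sample by the observed labels. -/
def interpolant (T : Pt d → ℝ) (A δ r : ℝ) (D : Sample d n) (x : Pt d) : ℝ :=
  T x + A * (bumpSum 1 δ r D x - bumpSum (-1) δ r D x)

theorem measurable_interpolant {T : Pt d → ℝ} (hT : Measurable T) (A δ r : ℝ) :
    Measurable fun p : Sample d n × Pt d => interpolant T A δ r p.1 p.2 :=
  (hT.comp measurable_snd).add
    (((measurable_bumpSum 1 δ r).sub (measurable_bumpSum (-1) δ r)).const_mul A)

theorem interpolant_eq_of_far (hd : 1 ≤ d) (T : Pt d → ℝ) (A : ℝ) {δ r : ℝ} (hr : 0 < r)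
    {D : Sample d n} {x : Pt d} (h : ∀ i, δ + r ≤ dist x (D i).1) :
    interpolant T A δ r D x = T x := by
  rw [interpolant, bumpSum_eq_zero hd _ hr h, bumpSum_eq_zero hd _ hr h]
  ring

theorem one_le_mul_interpolant (hd : 1 ≤ d) {T : Pt d → ℝ} {A : ℝ} (hT : ∀ x, |T x| + 1 ≤ A)
    {X : Set (Pt d)} {δ r : ℝ} (hδ : 0 < δ) (hr : 0 < r) (hrδ : r ≤ δ) {D : Sample d n}
    (hD : D ∈ separatedSamples d n X δ) (i : Fin n) {x : Pt d} (hx : dist x (D i).1 ≤ δ) :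
    1 ≤ (D i).2 * interpolant T A δ r D x := by
  have hfar : ∀ j ≠ i, δ + r ≤ dist x (D j).1 := by
    intro j hj
    have h1 := lt_dist_of_mem_separatedSamples hδ.le hD hj.symm
    have h2 := dist_triangle_left (D i).1 (D j).1 x
    linarith
  have hy : (D i).2 = -1 ∨ (D i).2 = 1 := (hD.1 i).2
  rw [interpolant, bumpSum_eq hd _ hr hx hfar, bumpSum_eq hd _ hr hx hfar]
  have h3 := hT x
  have h4 := neg_abs_le (T x)
  have h5 := le_abs_self (T x)
  rcases hy with h | h <;> rw [h] <;> norm_num <;> linarith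

/-- Size bounds and realization of the interpolating network. -/
theorem smul_interpolant_mem {w : ℕ → ℕ} {U m D' : ℕ} (hd : 1 ≤ d)
    (hU : d + 2 + 9 * (d + 1) ^ D' ≤ U) (hw1 : 2 * d + n * (2 * d) ≤ w 1) (hw2 : d + n ≤ w 2)
    (hw : ∀ ℓ, 3 ≤ ℓ → U + N + 3 ≤ w ℓ) (a : Fin N → (Fin D' → Option (Fin d)) → ℝ)
    (ζ A δ r s : ℝ) (D : Sample d n) {R : ℝ}
    (hR : (((2 * d + n * (2 * d)) * (d + 1) + (d + n) * (2 * d + 1) + (d + 2) * (d + n + 1)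
      + D' * (m + 1) * (U * (U + 1)) + (N + 3) * (U + 1) + (N + 3) : ℕ) : ℝ) ≤ R) :
    (fun x => s * interpolant (signNet m D' a ζ) A δ r D x) ∈
      sparseHypothesisSpace d (3 + D' * (m + 1) + 1) w R := by
  have h1 := isReadable_bumpSum (U := U) hd (by omega) hw1 hw2
    (by have := hw 3 le_rfl; omega) δ r D
  have h2 := h1.monoApprox m D' (by simpa using hU)
    (fun l hl => by have := hw l (by omega); omega) (by
      rintro (j | b) x
      · exact (clip_mem _).1
      · exact bumpSum_nonneg _ _ _ _ _) (fun j => mem_readout_self _ (Sum.inl j))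
  set V := Sum.elim (Sum.elim (fun (j : Fin d) (x : Pt d) => clip (x j))
    (fun (b : Bool) => bumpSum (if b then 1 else -1) δ r D)) (monoApprox (d := d) m D') with hV
  -- The last layer has one unit per polynomial, a constant unit that replaces the missing output
  -- bias, and the two bump sums.
  let G : Fin N ⊕ (Unit ⊕ Bool) → Pt d → ℝ := Sum.elim
    (fun c x => ∑ τ, a c τ * monoApprox m D' τ x)
    (Sum.elim (fun _ _ => 1) (fun b => bumpSum (if b then 1 else -1) δ r D))
  have hcard : Fintype.card (Fin N ⊕ (Unit ⊕ Bool)) = N + 3 := by simp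
  have h3 := h2.relu_isHidden (κ' := Fin N ⊕ (Unit ⊕ Bool))
    (hcard.trans_le (by have := hw (3 + D' * (m + 1) + 1) (by omega); omega)) G (by
      rintro (c | u | b)
      · have : G (Sum.inl c) = ∑ τ, a c τ • V (Sum.inr τ) := by
          funext x
          simp [G, hV, Finset.sum_apply]
        rw [this]
        exact Submodule.sum_mem _ fun τ _ => Submodule.smul_mem _ _ (mem_readout_self V _)
      · exact const_mem_readout _ 1
      · exact mem_readout_self V (Sum.inl (Sum.inr b)))
  rw [hcard] at h3
  have h4 := h3.mem_sparseHypothesisSpace (Sum.elim (fun _ => s)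
    (Sum.elim (fun _ => -(s * (ζ / 8))) (fun b => s * A * if b then 1 else -1))) (R := R)
    (by rw [hcard]; exact_mod_cast hR)
  convert h4 using 1
  funext x
  simp only [Fintype.sum_sum_type, Sum.elim_inl, Sum.elim_inr, G, Fintype.sum_bool,
    Finset.univ_unique, Finset.sum_singleton, ← Finset.mul_sum, if_true, Bool.false_eq_true,
    if_false, max_eq_left (bumpSum_nonneg _ _ _ _ _), max_eq_left zero_le_one]
  rw [interpolant, signNet]
  ring

theorem sparseHypothesisSpace_subset {L : ℕ} {w : ℕ → ℕ} {K : ℝ} {f : Pt d → ℝ}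
    (h : f ∈ sparseHypothesisSpace d L w K) : f ∈ hypothesisSpace d L w := by
  obtain ⟨M, -, rfl⟩ := h
  exact ⟨M, rfl⟩

/-- Take m = ⌈log c + 2 log(1/ζ)⌉ and use e ≤ 4. As log(1/ζ) ≥ 1/2, additive constants are absorbed
into multiples of log(1/ζ). -/
theorem exists_refinement {c : ℝ} (hc : 1 ≤ c) {ζ : ℝ} (hζ : 0 < ζ) (hζ2 : ζ ≤ 1 / 2) :
    ∃ m : ℕ, c / ζ ^ 2 ≤ 4 ^ m ∧ (m : ℝ) + 1 ≤ (2 * Real.log c + 6) * Real.log (1 / ζ) := by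
  have hlog : 1 / 2 ≤ Real.log (1 / ζ) := by
    have h1 : Real.log 2 ≤ Real.log (1 / ζ) := by
      refine Real.log_le_log (by norm_num) ?_
      rw [le_div_iff₀ hζ]
      linarith
    linarith [Real.log_two_gt_d9]
  have hlc := Real.log_nonneg hc
  have hle : 0 ≤ Real.log c + 2 * Real.log (1 / ζ) := by linarith
  refine ⟨⌈Real.log c + 2 * Real.log (1 / ζ)⌉₊, ?_, ?_⟩
  · have h1 := Nat.le_ceil (Real.log c + 2 * Real.log (1 / ζ))
    have h2 : c / ζ ^ 2 = Real.exp (Real.log c + 2 * Real.log (1 / ζ)) := by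
      rw [Real.exp_add, Real.exp_log (by linarith), two_mul, Real.exp_add,
        Real.exp_log (by positivity)]
      field_simp
    rw [h2]
    refine (Real.exp_le_exp.2 h1).trans ?_
    rw [← Real.exp_one_pow]
    gcongr
    linarith [Real.exp_one_lt_d9]
  · have h3 := Nat.ceil_lt_add_one hle
    nlinarith

theorem weight_bound {A A₁ t u C c l P Q m N n : ℝ} (hA : 0 ≤ A) (hA₁ : 0 ≤ A₁) (ht : 0 ≤ t)
    (hu : 0 ≤ u) (hC : 0 ≤ C) (hc : 0 ≤ c) (hn : 0 ≤ n) (hm : m ≤ c * l) (hN : N ≤ C * P)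
    (hl : l ≤ Q) (hP : P ≤ 2 * Q) (hQ : 1 ≤ 2 * Q) :
    A + A₁ * n + t * m + (N + 3) * u
      ≤ (A₁ + 2 * A + t * c + 2 * C * u + 6 * u) * (Q + n) := by
  have e1 : A ≤ A * (2 * Q) := le_mul_of_one_le_right hA hQ
  have e2 : 0 ≤ A₁ * Q := mul_nonneg hA₁ (by linarith)
  have e3 : 0 ≤ (2 * A + t * c + 2 * C * u + 6 * u) * n := by positivity
  have e4 : t * m ≤ t * (c * Q) :=
    mul_le_mul_of_nonneg_left (hm.trans (mul_le_mul_of_nonneg_left hl hc)) ht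
  have e5 : N ≤ C * (2 * Q) := hN.trans (mul_le_mul_of_nonneg_left hP hC)
  have e6 : (N + 3) * u ≤ (C * (2 * Q) + 3 * (2 * Q)) * u :=
    mul_le_mul_of_nonneg_right (by linarith) hu
  linarith

end Estimators

end AdvTrain

end

/-! ### Assembly: constants, architecture and risk bounds -/

theorem theorem6 (d α : ℕ) (hd : 1 ≤ d) (hα : 1 ≤ α) (B : ℝ) :
    ∃ C : ℝ, 0 < C ∧
      ∀ (X : Set (AdvTrain.Pt d)) (ρ : MeasureTheory.Measure (AdvTrain.Pt d × ℝ))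
        (η : AdvTrain.Pt d → ℝ) (ζ δ C₀ : ℝ) (n : ℕ),
        MeasurableSet X → X ⊆ AdvTrain.cube d →
        AdvTrain.IsDataDistribution X ρ →
        AdvTrain.IsCondProbOne X ρ η →
        AdvTrain.normJ X ρ < ⊤ → AdvTrain.normJbar X ρ < ⊤ →
        0 < δ → AdvTrain.WellSeparated X η δ →
        AdvTrain.InHolderBall α B X η →
        0 < ζ → (∀ x ∈ X, ζ < |η x - 1 / 2|) →
        0 < C₀ → C₀ ≤ 1 → 1 ≤ n →
        -- the architecture: depth `L` and widths `w 1, …, w L`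
        ∃ (L : ℕ) (w : ℕ → ℕ),
          1 ≤ L ∧ (L : ℝ) ≤ C * Real.log (1 / ζ) ∧
          (∀ ℓ, 1 ≤ ℓ → ℓ ≤ L → ℓ ≤ 2 →
            (w ℓ : ℝ) ≤ C * (ζ ^ (-(d : ℝ) / (α : ℝ)) * Real.log (1 / ζ) + n)) ∧
          (∀ ℓ, 3 ≤ ℓ → ℓ ≤ L →
            (w ℓ : ℝ) ≤ C * (ζ ^ (-(d : ℝ) / (α : ℝ)) * Real.log (1 / ζ))) ∧
          -- infinitely many estimators `g 0, g 1, …`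
          ∃ g : ℕ → AdvTrain.Sample d n → AdvTrain.Pt d → ℝ,
            (∀ k, Measurable fun p : AdvTrain.Sample d n × AdvTrain.Pt d => g k p.1 p.2) ∧
            (∀ D ∈ AdvTrain.separatedSamples d n X δ,
              Function.Injective fun k => X.domRestrict (g k D)) ∧
            -- which minimize the adversarial hinge risk
            (∀ k, ∀ D ∈ AdvTrain.separatedSamples d n X δ,
              g k D ∈ AdvTrain.advMinimizers AdvTrain.hinge δ D
                (AdvTrain.hypothesisSpace d L w)) ∧
            -- and whose multiples `log (1 / β) * g k D` have all the claimed properties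
            ∀ k, ∀ β : ℝ, 0 < β → β < 1 →
              (∀ D ∈ AdvTrain.separatedSamples d n X δ,
                (fun x => Real.log (1 / β) * g k D x) ∈
                  AdvTrain.sparseHypothesisSpace d L w
                    (C * (ζ ^ (-(d : ℝ) / (α : ℝ)) * Real.log (1 / ζ) + n)) ∧
                AdvTrain.advEmpRisk AdvTrain.logistic δ D
                  (fun x => Real.log (1 / β) * g k D x) ≤ β ∧
                AdvTrain.misclass ρ (fun x => AdvTrain.sgn (Real.log (1 / β) * g k D x))
                    - AdvTrain.misclass ρ (AdvTrain.bayes η)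
                  ≤ 2 * (AdvTrain.normJ X ρ).toReal * ((2 + 2 * C₀) * δ) ^ d * n ∧
                AdvTrain.advMisclass ρ X δ (fun x => AdvTrain.sgn (Real.log (1 / β) * g k D x))
                    - AdvTrain.bestAdvMisclass ρ X δ
                  ≤ 3 * (AdvTrain.normJ X ρ).toReal * ((4 + 2 * C₀) * δ) ^ d * n) ∧
              AdvTrain.expectSep n ρ X δ (fun D =>
                  AdvTrain.misclass ρ (fun x => AdvTrain.sgn (Real.log (1 / β) * g k D x))
                    - AdvTrain.misclass ρ (AdvTrain.bayes η))
                ≤ ENNReal.ofReal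
                    (2 * (AdvTrain.normJ X ρ).toReal * ((2 + 2 * C₀) * δ) ^ d * n) ∧
              AdvTrain.expectSep n ρ X δ (fun D =>
                  AdvTrain.advMisclass ρ X δ
                      (fun x => AdvTrain.sgn (Real.log (1 / β) * g k D x))
                    - AdvTrain.bestAdvMisclass ρ X δ)
                ≤ ENNReal.ofReal
                    (3 * (AdvTrain.normJ X ρ).toReal * ((4 + 2 * C₀) * δ) ^ d * n) := by
  obtain ⟨C₁, hC₁, hpoly⟩ := AdvTrain.exists_sign_polynomials d α hd hα B
  have hα' : (1 : ℝ) ≤ α := by exact_mod_cast hα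
  set c₁ : ℝ := 2 * Real.log (8 * α * C₁) + 6 with hc₁
  have hαC : 1 ≤ 8 * α * C₁ := by nlinarith
  have hc₁0 : 0 ≤ c₁ := by
    have := Real.log_nonneg hαC
    linarith
  set U : ℕ := d + 2 + 9 * (d + 1) ^ (2 * α) with hU
  set A₁ : ℝ := 2 * d * (d + 1) + (2 * d + 1) + (d + 2) with hA₁
  set A : ℝ := 2 * d * (d + 1) + d * (2 * d + 1) + (d + 2) * (d + 1) with hA
  set E₁ : ℝ := 8 + 2 * α * c₁ with hE₁
  set E₂ : ℝ := 4 * d + (2 * d + 1) with hE₂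
  set E₃ : ℝ := 2 * (U + 3) + 2 * C₁ with hE₃
  set E₄ : ℝ := A₁ + 2 * A + 2 * α * (U * (U + 1)) * c₁ + 2 * C₁ * (U + 2) + 6 * (U + 2) with hE₄
  have hA₁0 : 0 ≤ A₁ := by positivity
  have hA0 : 0 ≤ A := by positivity
  have hE₁0 : 0 < E₁ := by positivity
  have hE₂0 : 0 < E₂ := by positivity
  have hE₃0 : 0 < E₃ := by positivity
  have hE₄0 : 0 < E₄ := by positivity
  -- The four constants serve the depth, the first two widths, the later widths and the number of
  -- non-zero parameters.
  refine ⟨E₁ + E₂ + E₃ + E₄, by positivity, ?_⟩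
  intro X ρ η ζ δ C₀ n hX hXc hρ hη hJ _ hδ hsep hηB hζ hmargin hC₀ hC₀1 hn
  have hρ1 := hρ.1
  -- A probability measure charges some point of `X`, and there η lies in [0, 1]. This keeps
  -- log(1/ζ) away from 0.
  have hζ2 : ζ ≤ 1 / 2 := by
    obtain ⟨z, hz⟩ := (AdvTrain.ae_mem hρ).exists
    have h1 := hmargin z.1 hz.1
    have h2 := hη.2.1 z.1 hz.1
    refine h1.le.trans (abs_le.2 ⟨?_, ?_⟩) <;> linarith
  obtain ⟨N, hN, a, ha, hsign⟩ := hpoly X η ζ hXc hηB hζ hζ2 hmargin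
  obtain ⟨m, hm, hmle⟩ := AdvTrain.exists_refinement hαC hζ hζ2
  set P : ℝ := ζ ^ (-(d : ℝ) / (α : ℝ)) with hP
  set l : ℝ := Real.log (1 / ζ) with hl
  have hP1 : 1 ≤ P := Real.one_le_rpow_of_pos_of_le_one_of_nonpos hζ (by linarith)
    (div_nonpos_of_nonpos_of_nonneg (by simp) (by positivity))
  have hl1 : 1 / 2 ≤ l := by
    have h1 : Real.log 2 ≤ l := by
      refine Real.log_le_log (by norm_num) ?_
      rw [le_div_iff₀ hζ]
      linarith
    linarith [Real.log_two_gt_d9]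
  set Q : ℝ := P * l with hQ
  have hQl : l ≤ Q := le_mul_of_one_le_left (by linarith) hP1
  have hQ1 : 1 ≤ 2 * Q := by linarith
  have hQP : P ≤ 2 * Q := by
    have := le_mul_of_one_le_right (zero_le_one.trans hP1) (show 1 ≤ 2 * l by linarith)
    linarith
  have hn1 : (1 : ℝ) ≤ n := by exact_mod_cast hn
  have hQ0 : 0 < Q := by linarith
  set w : ℕ → ℕ := fun ℓ => if ℓ ≤ 2 then 2 * d + n * (2 * d) + n else U + N + 3 with hw
  set K : ℕ := (2 * d + n * (2 * d)) * (d + 1) + (d + n) * (2 * d + 1) + (d + 2) * (d + n + 1)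
      + 2 * α * (m + 1) * (U * (U + 1)) + (N + 3) * (U + 1) + (N + 3) with hK
  have hKle : (K : ℝ) ≤ (E₁ + E₂ + E₃ + E₄) * (Q + n) := by
    have h1 : (K : ℝ) = A + A₁ * n + 2 * α * (U * (U + 1)) * (m + 1) + (N + 3) * (U + 2) := by
      rw [hK, hA, hA₁]
      push_cast
      ring
    have h4 : (K : ℝ) ≤ E₄ * (Q + n) := by
      rw [h1, hE₄]
      exact AdvTrain.weight_bound hA0 hA₁0 (by positivity) (by positivity)
        (by linarith) hc₁0 (by linarith) hmle hN hQl hQP hQ1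
    exact h4.trans (mul_le_mul_of_nonneg_right (by linarith) (by linarith))
  set r : ℝ := C₀ * δ with hr
  have hr0 : 0 < r := by positivity
  have hrδ : r ≤ δ := mul_le_of_le_one_left hδ.le hC₀1
  set T := AdvTrain.signNet m (2 * α) a ζ with hT
  set M : ℝ := N * (C₁ / ζ) + ζ / 8 + 1 with hM
  have hTM : ∀ x, |T x| + 1 ≤ M := fun x => by
    have := AdvTrain.abs_signNet_le (m := m) hζ.le ha x
    linarith
  -- Coefficient sum times degree times the error of one product; this is why m was chosen with
  -- 8αC₁/ζ² ≤ 4^m.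
  have hε : C₁ / ζ * ((2 * α : ℕ) * (1 / 4 ^ m)) ≤ ζ / 4 := by
    have h4 : (0 : ℝ) < 4 ^ m := by positivity
    rw [div_le_iff₀ (by positivity)] at hm
    have e : C₁ / ζ * ((2 * α : ℕ) * (1 / 4 ^ m)) = (8 * α * C₁) / (4 * ζ * 4 ^ m) := by
      push_cast
      field_simp
      ring
    rw [e, div_le_iff₀ (by positivity)]
    linarith
  have hmem : ∀ (s : ℝ) (D : AdvTrain.Sample d n),
      (fun x => s * AdvTrain.interpolant T M δ r D x) ∈
        AdvTrain.sparseHypothesisSpace d (3 + 2 * α * (m + 1) + 1) w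
          ((E₁ + E₂ + E₃ + E₄) * (Q + n)) := fun s D =>
    AdvTrain.smul_interpolant_mem (U := U) hd le_rfl (by simp [hw]) (by
        have : d ≤ 2 * d + n * (2 * d) := Nat.le_add_right_of_le (by omega)
        simp only [hw, le_refl, if_true]
        omega)
      (fun ℓ hℓ => by
        have : ¬ ℓ ≤ 2 := by omega
        simp [hw, this]) a ζ M δ r s D hKle
  have hsgn : ∀ (s : ℝ), 0 < s → ∀ (D : AdvTrain.Sample d n), ∀ x ∈ X,
      (∀ i, (1 + C₀) * δ < dist x (D i).1) →
      AdvTrain.sgn (s * AdvTrain.interpolant T M δ r D x) = AdvTrain.bayes η x := by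
    intro s hs D x hx hfar
    rw [AdvTrain.interpolant_eq_of_far hd T M hr0 fun i => by
      have := hfar i
      linarith]
    exact AdvTrain.sgn_mul_signNet hζ hs ha hε (hXc hx) (hsign x hx).1 (hsign x hx).2
  have hJ0 : 0 ≤ (AdvTrain.normJ X ρ).toReal := ENNReal.toReal_nonneg
  have hrisk : ∀ (s : ℝ), 0 < s → ∀ (D : AdvTrain.Sample d n),
      AdvTrain.misclass ρ (fun x => AdvTrain.sgn (s * AdvTrain.interpolant T M δ r D x))
        - AdvTrain.misclass ρ (AdvTrain.bayes η)
      ≤ 2 * (AdvTrain.normJ X ρ).toReal * ((2 + 2 * C₀) * δ) ^ d * n := by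
    intro s hs D
    refine (AdvTrain.misclass_sub_le D hρ hJ (by positivity) _ (hsgn s hs D)).trans ?_
    rw [← mul_assoc, show 2 * (1 + C₀) = 2 + 2 * C₀ by ring]
    gcongr
    linarith
  have hadv : ∀ (s : ℝ), 0 < s → ∀ (D : AdvTrain.Sample d n),
      AdvTrain.advMisclass ρ X δ (fun x => AdvTrain.sgn (s * AdvTrain.interpolant T M δ r D x))
        - AdvTrain.bestAdvMisclass ρ X δ
      ≤ 3 * (AdvTrain.normJ X ρ).toReal * ((4 + 2 * C₀) * δ) ^ d * n := by
    intro s hs D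
    refine (AdvTrain.advMisclass_sub_le D hX hρ hη hJ hδ hsep (by positivity) _
      (hsgn s hs D)).trans ?_
    rw [show 2 * ((1 + C₀) * δ + δ) = (4 + 2 * C₀) * δ by ring]
    gcongr
    linarith
  refine ⟨3 + 2 * α * (m + 1) + 1, w, by omega, ?_, ?_, ?_,
    fun k D x => ((k : ℝ) + 1) * AdvTrain.interpolant T M δ r D x, ?_, ?_, ?_, ?_⟩
  · have h1 : ((3 + 2 * α * (m + 1) + 1 : ℕ) : ℝ) ≤ E₁ * l := by
      push_cast
      have : 2 * (α : ℝ) * (m + 1) ≤ 2 * α * (c₁ * l) := by gcongr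
      rw [hE₁]
      linarith
    refine h1.trans ?_
    gcongr
    linarith
  · intro ℓ _ _ hℓ
    have h1 : (w ℓ : ℝ) ≤ E₂ * (Q + n) := by
      simp only [hw, hℓ, if_true]
      push_cast
      rw [hE₂]
      have hd0 : (0 : ℝ) ≤ d := by positivity
      have e1 := mul_nonneg hd0 hQ0.le
      have e2 := mul_nonneg hd0 (zero_le_one.trans hn1)
      have e3 := mul_le_mul_of_nonneg_left hQ1 hd0
      linarith
    refine h1.trans ?_
    gcongr
    linarith
  · intro ℓ hℓ _
    have h1 : (w ℓ : ℝ) ≤ E₃ * Q := by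
      have : ¬ ℓ ≤ 2 := by omega
      simp only [hw, this, if_false]
      push_cast
      have e1 : C₁ * P ≤ C₁ * (2 * Q) := by gcongr
      have e2 : (U : ℝ) + 3 ≤ (U + 3) * (2 * Q) := le_mul_of_one_le_right (by positivity) hQ1
      rw [hE₃]
      linarith
    refine h1.trans ?_
    gcongr
    linarith
  · intro k
    exact (AdvTrain.measurable_interpolant (AdvTrain.measurable_signNet _ _ _ _) M δ r).const_mul _
  · intro D hD k k' hkk
    -- Two multiples are told apart at a sample point, where the margin shows that the interpolant
    -- is non-zero.
    have hx := (hD.1 ⟨0, hn⟩).1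
    have h1 := congrFun hkk ⟨_, hx⟩
    change ((k : ℝ) + 1) * AdvTrain.interpolant T M δ r D (D ⟨0, hn⟩).1
      = ((k' : ℝ) + 1) * AdvTrain.interpolant T M δ r D (D ⟨0, hn⟩).1 at h1
    have h2 := AdvTrain.one_le_mul_interpolant hd hTM hδ hr0 hrδ hD ⟨0, hn⟩
      (x := (D ⟨0, hn⟩).1) (by simpa using hδ.le)
    have h3 : AdvTrain.interpolant T M δ r D (D ⟨0, hn⟩).1 ≠ 0 := by
      intro h0
      rw [h0, mul_zero] at h2
      linarith
    have h4 := mul_right_cancel₀ h3 h1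
    exact_mod_cast add_right_cancel h4
  · intro k D hD
    refine AdvTrain.mem_advMinimizers_hinge
      (AdvTrain.sparseHypothesisSpace_subset (hmem _ D)) fun i x hx => ?_
    have h1 := AdvTrain.one_le_mul_interpolant hd hTM hδ hr0 hrδ hD i hx
    have h2 : (1 : ℝ) ≤ (k : ℝ) + 1 := by simp
    calc (1 : ℝ) ≤ ((k : ℝ) + 1) * ((D i).2 * AdvTrain.interpolant T M δ r D x) :=
          one_le_mul_of_one_le_of_one_le h2 h1
      _ = _ := by ring
  · intro k β hβ hβ1
    have hlog : 0 < Real.log (1 / β) := Real.log_pos ((one_lt_div hβ).2 hβ1)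
    have hs : 0 < Real.log (1 / β) * ((k : ℝ) + 1) := by positivity
    simp only [← mul_assoc (Real.log (1 / β)) ((k : ℝ) + 1)]
    refine ⟨fun D hD => ⟨hmem _ D, AdvTrain.advEmpRisk_logistic_le hβ fun i x hx => ?_,
      hrisk _ hs D, hadv _ hs D⟩, AdvTrain.expectSep_le n hX δ _ _ fun D _ => hrisk _ hs D,
      AdvTrain.expectSep_le n hX δ _ _ fun D _ => hadv _ hs D⟩
    have h1 := AdvTrain.one_le_mul_interpolant hd hTM hδ hr0 hrδ hD i hx
    have h2 : (1 : ℝ) ≤ (k : ℝ) + 1 := by simp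
    calc Real.log (1 / β) ≤ Real.log (1 / β) * ((k : ℝ) + 1) :=
          le_mul_of_one_le_right hlog.le h2
      _ ≤ Real.log (1 / β) * ((k : ℝ) + 1) *
          ((D i).2 * AdvTrain.interpolant T M δ r D x) := le_mul_of_one_le_right hs.le h1
      _ = _ := by ring
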